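/- Let $G=\sum_{n\ge0}(-1)^n/(2n+1)^2$ be Catalan's constant. Let $h_0,\dots,h_4$ be real numbers, put $a_1=1+h_0-h_1-h_2$, $a_2=h_3$, $a_3=h_4$, $b_2=1+h_0-h_1$, $b_3=1+h_0-h_2$ (any real $a_1,a_2,a_3,b_2,b_3$ arise in this way), and let $\mathbf c$ be the set of the ten numbers $$c_{00}=(b_2+b_3)-(a_1+a_2+a_3)-1,\qquad c_{j1}=a_j-1,\qquad c_{jl}=b_l-a_j-1\quad(l=2,3;\ j=1,2,3).$$ Let $\mathfrak G\subset\mathfrak S_{10}$ be the group, of order $120$, of permutations of the ten labels generated by $$(c_{11}\,c_{31})(c_{12}\,c_{32})(c_{13}\,c_{33}),\quad (c_{21}\,c_{31})(c_{22}\,c_{32})(c_{23}\,c_{33}),\quad (c_{12}\,c_{13})(c_{22}\,c_{23})(c_{32}\,c_{33}),\quad (c_{00}\,c_{22})(c_{11}\,c_{33})(c_{13}\,c_{31});$$ for $\sigma\in\mathfrak G$ the permuted set $\sigma\mathbf c$ is again of the above form (for other values of the parameters). Suppose that all elements of $\mathbf c$ are $>-1$. Define $H(\mathbf c)$ by the (convergent)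 double integral $$H(\mathbf c)=\int_0^1\!\!\int_0^1\frac{x^{c_{21}}(1-x)^{c_{22}}\,y^{c_{31}}(1-y)^{c_{33}}}{(1-xy)^{c_{11}+1}}\,dx\,dy,$$ or, equivalently, by the (convergent) series $$H(\mathbf c)=\frac{\Gamma(a_2)\Gamma(a_3)\Gamma(b_2-a_2)\Gamma(b_3-a_3)}{\Gamma(b_2)\Gamma(b_3)}\;{}_3F_2\!\left(\begin{matrix}a_1,\,a_2,\,a_3\\ b_2,\,b_3\end{matrix}\,\middle|\,1\right),$$ or, equivalently, if $h_0\ne0$, by $$H(\mathbf c)=\frac{\Gamma(1+h_0)\Gamma(h_3)\Gamma(h_4)\Gamma(1+h_0-h_1-h_3)\Gamma(1+h_0-h_2-h_4)\Gamma(1+h_0-h_3-h_4)}{\Gamma(1+h_0-h_1)\Gamma(1+h_0-h_2)\Gamma(1+h_0-h_3)\Gamma(1+h_0-h_4)}\;{}_6F_5\!\left(\begin{matrix}h_0,\,1+\frac12h_0,\,h_1,\,h_2,\,h_3,\,h_4\\ \frac12h_0,\,1+h_0-h_1,\,1+h_0-h_2,\,1+h_0-h_3,\,1+h_0-h_4\end{matrix}\,\middle|\,-1\right),$$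 where the value of ${}_6F_5$ at $-1$ is the limit of ${}_6F_5(\cdots|z)$ as $z\to-1$, $-1<z\le0$ (the sum of the series at $-1$ whenever that series converges). Then: (i) for every $\sigma\in\mathfrak G$ one has $\dfrac{H(\sigma\mathbf c)}{\Pi(\sigma\mathbf c)}=\dfrac{H(\mathbf c)}{\Pi(\mathbf c)}$, where $$\Pi(\mathbf c)=\Gamma(c_{00}+1)\,\Gamma(c_{21}+1)\,\Gamma(c_{22}+1)\,\Gamma(c_{33}+1)\,\Gamma(c_{31}+1);$$ (ii) if, for some $\sigma\in\mathfrak G$, the set $\sigma\mathbf c$ satisfies the condition $c_{00},c_{21},c_{33}\in\mathbb Z+\tfrac12$ and $c_{22},c_{31}\in\mathbb Z$, then $H(\mathbf c)\in\mathbb QG+\mathbb Q$. -/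

import Mathlib

open MeasureTheory Filter Topology Set

namespace CatalanForms

/-- The ten labels `00` and `jl` (`j, l = 1, 2, 3`) of the elements of the set `c`. -/
inductive Idx : Type
  | c00 | c11 | c12 | c13 | c21 | c22 | c23 | c31 | c32 | c33
  deriving DecidableEq

open Idx

/-- The 10-element set `c` attached to `a₁, a₂, a₃; b₂, b₃`:
`c₀₀ = (b₂ + b₃) - (a₁ + a₂ + a₃) - 1`, `c_{j1} = a_j - 1`, and `c_{jl} = b_l - a_j - 1`
for `l = 2, 3`. -/
def paramSet (a₁ a₂ a₃ b₂ b₃ : ℝ) : Idx → ℝ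
  | c00 => (b₂ + b₃) - (a₁ + a₂ + a₃) - 1
  | c11 => a₁ - 1
  | c12 => b₂ - a₁ - 1
  | c13 => b₃ - a₁ - 1
  | c21 => a₂ - 1
  | c22 => b₂ - a₂ - 1
  | c23 => b₃ - a₂ - 1
  | c31 => a₃ - 1
  | c32 => b₂ - a₃ - 1
  | c33 => b₃ - a₃ - 1

/-- The 10-element sets under consideration. -/
def IsParamSet (c : Idx → ℝ) : Prop :=
  ∃ a₁ a₂ a₃ b₂ b₃ : ℝ, c = paramSet a₁ a₂ a₃ b₂ b₃

/-- The permutation `(a₁ a₃)`. -/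
def permA₁ : Equiv.Perm Idx :=
  Equiv.swap c11 c31 * Equiv.swap c12 c32 * Equiv.swap c13 c33

/-- The permutation `(a₂ a₃)`. -/
def permA₂ : Equiv.Perm Idx :=
  Equiv.swap c21 c31 * Equiv.swap c22 c32 * Equiv.swap c23 c33

/-- The permutation `(b₂ b₃)`. -/
def permB : Equiv.Perm Idx :=
  Equiv.swap c12 c13 * Equiv.swap c22 c23 * Equiv.swap c32 c33

/-- The permutation `(h₁ h₄)`. -/
def permH : Equiv.Perm Idx :=
  Equiv.swap c00 c22 * Equiv.swap c11 c33 * Equiv.swap c13 c31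

/-- The group generated by the four permutations above. -/
def permGroup : Subgroup (Equiv.Perm Idx) :=
  Subgroup.closure {permA₁, permA₂, permB, permH}

/-- The set `σc`: the permutation `σ` of the labels applied to the set `c`. -/
def act (σ : Equiv.Perm Idx) (c : Idx → ℝ) : Idx → ℝ := fun i => c (σ⁻¹ i)

/-- The integrand of the double integral `H(c)`. -/
noncomputable def integrand (c : Idx → ℝ) (p : ℝ × ℝ) : ℝ :=
  p.1 ^ c c21 * (1 - p.1) ^ c c22 * p.2 ^ c c31 * (1 - p.2) ^ c c33 /
    (1 - p.1 * p.2) ^ (c c11 + 1)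

/-- The open unit square. -/
def unitSquare : Set (ℝ × ℝ) := Ioo (0 : ℝ) 1 ×ˢ Ioo (0 : ℝ) 1

/-- The double integral `H(c)`. -/
noncomputable def H (c : Idx → ℝ) : ℝ := ∫ p in unitSquare, integrand c p

/-- The product of Gamma values attached to `c`. -/
noncomputable def gammaProd (c : Idx → ℝ) : ℝ :=
  Real.Gamma (c c00 + 1) * Real.Gamma (c c21 + 1) * Real.Gamma (c c22 + 1) *
    Real.Gamma (c c33 + 1) * Real.Gamma (c c31 + 1)

/-- The coefficient `∏ (aᵢ)ₙ / (n! ∏ (bⱼ)ₙ)` of `zⁿ` in the generalized hypergeometric series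
with upper parameters `a` and lower parameters `b`. -/
noncomputable def hgCoeff (a b : List ℝ) (n : ℕ) : ℝ :=
  (a.map fun x => (ascPochhammer ℝ n).eval x).prod /
    ((n.factorial : ℝ) * (b.map fun x => (ascPochhammer ℝ n).eval x).prod)

/-- The series `∑ f n` has Abel sum `s`. By Abel's theorem this is the ordinary sum whenever the
series converges; for `f n = (coefficient of zⁿ) * (-1)ⁿ` it is the limit of the power series as
`z → -1` along `(-1, 0]`. -/
def HasAbelSum (f : ℕ → ℝ) (s : ℝ) : Prop :=
  (∀ r ∈ Ico (0 : ℝ) 1, Summable fun n => f n * r ^ n) ∧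
    Tendsto (fun r : ℝ => ∑' n, f n * r ^ n) (𝓝[<] 1) (𝓝 s)

/-- The `n`-th term of the `₃F₂`-series at `1`, multiplied by its gamma factors. -/
noncomputable def term₃F₂ (a₁ a₂ a₃ b₂ b₃ : ℝ) (n : ℕ) : ℝ :=
  Real.Gamma a₂ * Real.Gamma a₃ * Real.Gamma (b₂ - a₂) * Real.Gamma (b₃ - a₃) /
      (Real.Gamma b₂ * Real.Gamma b₃) *
    (hgCoeff [a₁, a₂, a₃] [b₂, b₃] n * 1 ^ n)

/-- The `n`-th term of the very-well-poised `₆F₅`-series at `-1`, multiplied by its gamma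
factors. -/
noncomputable def term₆F₅ (h₀ h₁ h₂ h₃ h₄ : ℝ) (n : ℕ) : ℝ :=
  Real.Gamma (1 + h₀) * Real.Gamma h₃ * Real.Gamma h₄ * Real.Gamma (1 + h₀ - h₁ - h₃) *
        Real.Gamma (1 + h₀ - h₂ - h₄) * Real.Gamma (1 + h₀ - h₃ - h₄) /
      (Real.Gamma (1 + h₀ - h₁) * Real.Gamma (1 + h₀ - h₂) *
        Real.Gamma (1 + h₀ - h₃) * Real.Gamma (1 + h₀ - h₄)) *
    (hgCoeff [h₀, 1 + h₀ / 2, h₁, h₂, h₃, h₄]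
        [h₀ / 2, 1 + h₀ - h₁, 1 + h₀ - h₂, 1 + h₀ - h₃, 1 + h₀ - h₄] n * (-1) ^ n)

/-- `x ∈ ℤ`. -/
def IsInt (x : ℝ) : Prop := ∃ m : ℤ, x = m

/-- `x ∈ ℤ + 1/2`. -/
def IsHalfInt (x : ℝ) : Prop := ∃ m : ℤ, x = m + 1 / 2

/-- The half-integrality condition on `c`. -/
def HalfIntegrality (c : Idx → ℝ) : Prop :=
  IsHalfInt (c c00) ∧ IsHalfInt (c c21) ∧ IsHalfInt (c c33) ∧ IsInt (c c22) ∧ IsInt (c c31)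

/-- Catalan's constant `G = ∑ (-1)ⁿ / (2n + 1)²`. -/
noncomputable def catalanG : ℝ := ∑' n : ℕ, (-1 : ℝ) ^ n / (2 * (n : ℝ) + 1) ^ 2

end CatalanForms

open CatalanForms

namespace CatalanForms

open Idx

/-! Expanding `(1 - xy)^(-a₁)` by the binomial series and integrating against beta densities turns
the double integral into the `₃F₂`-series (`hasSum_term₃F₂`). Divided by `gammaProd`, that series is
visibly symmetric in the `aⱼ` and in the `bₗ`, which settles three generators. The fourth, up to
`permA₁`, is Euler's transformation of the integral over `y` (`H_euler_transformation`). Read as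
two-element subsets of a five-element set, the labels are permuted by the whole symmetric group of
degree five, whence the order 120.

The `₆F₅`-expression rests on a quadratic transformation of a shorter very-well-poised series
(`poisedSum_neg_eq`), whose coefficient identity is the Pfaff–Saalschütz sum. Integrating both sides
over the unit square against two beta densities produces the `₆F₅`-series at `-1` on one side. On
the other side each term is a Dirichlet integral (`integral_betaWeight_mul_rpow`), and the results
are the `₃F₂` terms. The series at `-1` need not converge, so it is summed in Abel's sense
throughout.

For the arithmetic claim, the half-integrality condition makes the `n`-th `₆F₅` term `(-1)ⁿ f(n)` up
to a rational factor, where `f` is a rational function over `ℚ` with at most triple poles, all at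
half-integers, and `f(-N - z) = -(-1)ᴺ f(z)` with `N = h₀`. By partial fractions the Abel sum is a
rational combination of `1` and the alternating sums of `(n + 1/2)⁻ʲ`, `j = 1, 2, 3`. Comparison
with the reflected series cancels `j = 1` and `j = 3`, and `j = 2` gives `4G`
(`exists_hasAbelSum_catalanG`).

Finally, invariance carries the result from `σc` back to `c`: both Gamma products are nonzero
rational multiples of `√π ^ 3`, so the factor between the two values of `H` is rational
(`IsStar.exists_gammaProd`). -/

/-- The rising factorial `x (x + 1) ⋯ (x + n - 1)`. -/
noncomputable def rising (x : ℝ) (n : ℕ) : ℝ := (ascPochhammer ℝ n).eval x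

/-! ### Rising factorials and the binomial series. -/

@[simp] lemma rising_zero (x : ℝ) : rising x 0 = 1 := by simp [rising]

lemma rising_succ (x : ℝ) (n : ℕ) : rising x (n + 1) = rising x n * (x + n) := by
  simp [rising, ascPochhammer_succ_eval]

lemma rising_add (x : ℝ) (m n : ℕ) : rising x (m + n) = rising x m * rising (x + m) n := by
  induction n with
  | zero => simp
  | succ n ih => rw [← add_assoc, rising_succ, ih, rising_succ]; push_cast; ring

lemma rising_succ' (x : ℝ) (n : ℕ) : rising x (n + 1) = x * rising (x + 1) n := by
  rw [add_comm n 1, rising_add, rising_succ]; simp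

lemma rising_pos {x : ℝ} (hx : 0 < x) (n : ℕ) : 0 < rising x n := ascPochhammer_pos n x hx

lemma Gamma_add_natCast {x : ℝ} (hx : 0 < x) (n : ℕ) :
    Real.Gamma (x + n) = rising x n * Real.Gamma x := by
  induction n with
  | zero => simp
  | succ n ih =>
    rw [rising_succ, mul_right_comm, ← ih]
    push_cast
    rw [← add_assoc, Real.Gamma_add_one (by positivity)]; ring

lemma rising_le_rising {x y : ℝ} (hx : 0 < x) (hxy : x ≤ y) (n : ℕ) : rising x n ≤ rising y n := by
  induction n with
  | zero => simp
  | succ n ih =>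
    rw [rising_succ, rising_succ]
    have := rising_pos (hx.trans_le hxy) n
    gcongr

lemma rising_one (n : ℕ) : rising 1 n = n.factorial := by
  simp [rising]

/-- The coefficients of the binomial series. -/
lemma hasSum_binomial (a : ℝ) {x : ℝ} (hx : |x| < 1) :
    HasSum (fun n : ℕ => rising a n / n.factorial * x ^ n) ((1 - x) ^ (-a)) := by
  have h := (Real.one_div_one_sub_rpow_hasFPowerSeriesOnBall_zero a).hasSum (y := x) (by
    simpa [Metric.mem_eball, edist_dist, Real.dist_eq] using hx)
  rw [zero_add, one_div, ← Real.rpow_neg (by linarith [(abs_lt.1 hx).2])] at h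
  convert! h using 2 with n
  rw [FormalMultilinearSeries.ofScalars_apply_eq, ← Ring.multichoose_eq, smul_eq_mul]
  congr 1
  have h := Ring.factorial_nsmul_multichoose_eq_ascPochhammer a n
  rw [Polynomial.ascPochhammer_smeval_eq_eval] at h
  rw [rising, ← h, nsmul_eq_mul]
  field_simp

/-! ### Beta integrals -/

open ProbabilityTheory (beta)

lemma beta_add_natCast {u v : ℝ} (hu : 0 < u) (hv : 0 < v) (n : ℕ) :
    beta (u + n) v = beta u v * (rising u n / rising (u + v) n) := by
  have h1 := rising_pos (add_pos hu hv) n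
  have h2 := Real.Gamma_pos_of_pos (add_pos hu hv)
  rw [beta, beta, add_right_comm, Gamma_add_natCast hu, Gamma_add_natCast (add_pos hu hv)]
  field_simp

lemma integrableOn_beta {u v : ℝ} (hu : 0 < u) (hv : 0 < v) :
    IntegrableOn (fun x : ℝ => x ^ (u - 1) * (1 - x) ^ (v - 1)) (Ioo 0 1) := by
  have h : IntegrableOn _ _ _ := (intervalIntegrable_iff_integrableOn_Ioo_of_le zero_le_one
    ).1 (Complex.betaIntegral_convergent (u := u) (v := v) (by simpa) (by simpa))
  refine (Integrable.re h).congr ?_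
  refine (ae_restrict_mem measurableSet_Ioo).mono fun x hx => ?_
  have h1 : ((x : ℂ) ^ ((u : ℂ) - 1) * (1 - (x : ℂ)) ^ ((v : ℂ) - 1)) =
      ((x ^ (u - 1) * (1 - x) ^ (v - 1) : ℝ) : ℂ) := by
    push_cast
    rw [Complex.ofReal_cpow hx.1.le, Complex.ofReal_cpow (by linarith [hx.2])]
    push_cast; rfl
  simp only [h1]
  rfl

lemma integral_beta {u v : ℝ} (hu : 0 < u) (hv : 0 < v) :
    ∫ x in Ioo (0 : ℝ) 1, x ^ (u - 1) * (1 - x) ^ (v - 1) = beta u v := by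
  rw [ProbabilityTheory.beta_eq_betaIntegralReal u v hu hv, Complex.betaIntegral,
    intervalIntegral.integral_of_le zero_le_one, integral_Ioc_eq_integral_Ioo,
    ← RCLike.re_to_complex, ← integral_re]
  · refine setIntegral_congr_fun measurableSet_Ioo fun x hx => ?_
    have h1 : ((x : ℂ) ^ ((u : ℂ) - 1) * (1 - (x : ℂ)) ^ ((v : ℂ) - 1)) =
        ((x ^ (u - 1) * (1 - x) ^ (v - 1) : ℝ) : ℂ) := by
      push_cast
      rw [Complex.ofReal_cpow hx.1.le, Complex.ofReal_cpow (by linarith [hx.2])]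
      push_cast; rfl
    simp only [h1]
    rfl
  · exact (intervalIntegrable_iff_integrableOn_Ioo_of_le zero_le_one).1
      (Complex.betaIntegral_convergent (u := u) (v := v) (by simpa) (by simpa))

/-- A product of two beta densities on the unit square. -/
noncomputable def betaWeight (α u β v : ℝ) (p : ℝ × ℝ) : ℝ :=
  p.1 ^ (α - 1) * (1 - p.1) ^ (u - 1) * (p.2 ^ (β - 1) * (1 - p.2) ^ (v - 1))

@[fun_prop]
lemma measurable_betaWeight (α u β v : ℝ) : Measurable (betaWeight α u β v) := by
  unfold betaWeight; fun_prop

lemma measurableSet_unitSquare : MeasurableSet unitSquare :=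
  measurableSet_Ioo.prod measurableSet_Ioo

lemma volume_restrict_unitSquare :
    (volume : Measure (ℝ × ℝ)).restrict unitSquare =
      (volume.restrict (Ioo (0 : ℝ) 1)).prod (volume.restrict (Ioo (0 : ℝ) 1)) := by
  rw [Measure.prod_restrict]; rfl

lemma betaWeight_pos {α u β v : ℝ} {p : ℝ × ℝ} (hp : p ∈ unitSquare) :
    0 < betaWeight α u β v p := by
  obtain ⟨⟨h1, h2⟩, h3, h4⟩ := hp
  have := Real.rpow_pos_of_pos h1 (α - 1)
  have := Real.rpow_pos_of_pos (sub_pos.2 h2) (u - 1)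
  have := Real.rpow_pos_of_pos h3 (β - 1)
  have := Real.rpow_pos_of_pos (sub_pos.2 h4) (v - 1)
  unfold betaWeight; positivity

lemma mul_mem_Ioo_of_mem_unitSquare {p : ℝ × ℝ} (hp : p ∈ unitSquare) : p.1 * p.2 ∈ Ioo (0 : ℝ) 1 :=
  ⟨mul_pos hp.1.1 hp.2.1, mul_lt_one_of_nonneg_of_lt_one_left hp.1.1.le hp.1.2 hp.2.2.le⟩

lemma integrableOn_betaWeight {α u β v : ℝ} (hα : 0 < α) (hu : 0 < u) (hβ : 0 < β) (hv : 0 < v) :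
    IntegrableOn (betaWeight α u β v) unitSquare := by
  rw [IntegrableOn, volume_restrict_unitSquare]
  exact (integrableOn_beta hα hu).mul_prod (integrableOn_beta hβ hv)

lemma integral_betaWeight {α u β v : ℝ} (hα : 0 < α) (hu : 0 < u) (hβ : 0 < β) (hv : 0 < v) :
    ∫ p in unitSquare, betaWeight α u β v p = beta α u * beta β v := by
  rw [volume_restrict_unitSquare, ← integral_beta hα hu, ← integral_beta hβ hv]
  exact integral_prod_mul (fun x : ℝ => x ^ (α - 1) * (1 - x) ^ (u - 1))
    (fun x : ℝ => x ^ (β - 1) * (1 - x) ^ (v - 1))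

lemma betaWeight_mul_pow {α u β v : ℝ} {p : ℝ × ℝ} (hp : p ∈ unitSquare) (n : ℕ) :
    betaWeight α u β v p * (p.1 * p.2) ^ n = betaWeight (α + n) u (β + n) v p := by
  unfold betaWeight
  rw [add_sub_right_comm, add_sub_right_comm, Real.rpow_add_natCast hp.1.1.ne',
    Real.rpow_add_natCast hp.2.1.ne', mul_pow]
  ring

/-- Integrating a power series in `xy` termwise against a product of beta densities. -/
lemma hasSum_integral_betaWeight {α u β v : ℝ} (hα : 0 < α) (hu : 0 < u) (hβ : 0 < β) (hv : 0 < v)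
    {d : ℕ → ℝ} {g D : ℝ → ℝ} {m : ℕ → ℝ → ℝ}
    (hg : ∀ t ∈ Ioo (0 : ℝ) 1, HasSum (fun n => d n * t ^ n) (g t))
    (hm : ∀ n, ∀ t ∈ Ioo (0 : ℝ) 1, |d n| * t ^ n ≤ m n t)
    (hD : ∀ t ∈ Ioo (0 : ℝ) 1, HasSum (fun n => m n t) (D t))
    (hint : IntegrableOn (fun p => betaWeight α u β v p * D (p.1 * p.2)) unitSquare) :
    HasSum (fun n : ℕ => d n * (beta (α + n) u * beta (β + n) v))
      (∫ p in unitSquare, betaWeight α u β v p * g (p.1 * p.2)) := by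
  have h := hasSum_integral_of_dominated_convergence
    (μ := (volume : Measure (ℝ × ℝ)).restrict unitSquare)
    (F := fun n p => betaWeight α u β v p * (d n * (p.1 * p.2) ^ n))
    (f := fun p => betaWeight α u β v p * g (p.1 * p.2))
    (fun n p => betaWeight α u β v p * m n (p.1 * p.2))
    (fun n => by fun_prop) ?_ ?_ ?_ ?_
  · refine h.congr_fun fun n => ?_
    rw [← integral_betaWeight (by positivity) hu (by positivity) hv, ← integral_const_mul]
    refine setIntegral_congr_fun measurableSet_unitSquare fun p hp => ?_
    simp only [← betaWeight_mul_pow hp]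
    ring
  · refine fun n => (ae_restrict_mem measurableSet_unitSquare).mono fun p hp => ?_
    rw [norm_mul, norm_mul, Real.norm_of_nonneg (betaWeight_pos hp).le, Real.norm_eq_abs,
      Real.norm_of_nonneg (pow_nonneg (mul_mem_Ioo_of_mem_unitSquare hp).1.le n)]
    exact mul_le_mul_of_nonneg_left (hm n _ (mul_mem_Ioo_of_mem_unitSquare hp)) (betaWeight_pos hp).le
  · exact (ae_restrict_mem measurableSet_unitSquare).mono fun p hp =>
      ((hD _ (mul_mem_Ioo_of_mem_unitSquare hp)).mul_left _).summable
  · refine hint.congr ((ae_restrict_mem measurableSet_unitSquare).mono fun p hp => ?_)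
    exact (((hD _ (mul_mem_Ioo_of_mem_unitSquare hp)).mul_left _).tsum_eq).symm
  · exact (ae_restrict_mem measurableSet_unitSquare).mono fun p hp =>
      (hg _ (mul_mem_Ioo_of_mem_unitSquare hp)).mul_left _

/-! ### The double integral and the `₃F₂`-series -/

/-- Since `1 - xy` is at least `1 - x` and at least `1 - y`, the singular factor is bounded by a
product of powers of these, and the powers are absorbed into the two beta densities. -/
lemma integrableOn_betaWeight_mul_rpow {α u β v a : ℝ} (hα : 0 < α) (hu : 0 < u) (hβ : 0 < β)
    (hv : 0 < v) (ha : 0 < a) (h : a < u + v) :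
    IntegrableOn (fun p => betaWeight α u β v p * (1 - p.1 * p.2) ^ (-a)) unitSquare := by
  -- Splitting `a` in the ratio `u : v` leaves the exponents `u (u + v - a) / (u + v)` and `v (u + v
  -- - a) / (u + v)`, both positive.
  set θ := u / (u + v) with hθ
  have huv : 0 < u + v := add_pos hu hv
  have h1 : 0 < u - a * θ := by
    rw [hθ, sub_pos, ← mul_div_assoc, div_lt_iff₀ huv]; nlinarith
  have h2 : 1 - θ = v / (u + v) := by rw [hθ]; field_simp; ring
  have h3 : 0 < v - a * (1 - θ) := by
    rw [h2, sub_pos, ← mul_div_assoc, div_lt_iff₀ huv]; nlinarith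
  have hθ0 : 0 ≤ θ := by positivity
  have hθ1 : 0 ≤ 1 - θ := by rw [h2]; positivity
  refine Integrable.mono' (integrableOn_betaWeight hα h1 hβ h3) (by fun_prop) ?_
  refine (ae_restrict_mem measurableSet_unitSquare).mono fun p hp => ?_
  have hm := mul_mem_Ioo_of_mem_unitSquare hp
  have hT : 0 < 1 - p.1 * p.2 := sub_pos.2 hm.2
  rw [Real.norm_of_nonneg (mul_nonneg (betaWeight_pos hp).le (Real.rpow_nonneg hT.le _))]
  obtain ⟨⟨hx0, hx1⟩, hy0, hy1⟩ := hp
  have hX : 0 < 1 - p.1 := sub_pos.2 hx1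
  have hY : 0 < 1 - p.2 := sub_pos.2 hy1
  have key : (1 - p.1 * p.2) ^ (-a) ≤ (1 - p.1) ^ (-(a * θ)) * (1 - p.2) ^ (-(a * (1 - θ))) := by
    have e : -a = -(a * θ) + -(a * (1 - θ)) := by ring
    rw [e, Real.rpow_add hT]
    have hxT : 1 - p.1 ≤ 1 - p.1 * p.2 := by nlinarith
    have hyT : 1 - p.2 ≤ 1 - p.1 * p.2 := by nlinarith
    have := Real.rpow_nonneg hT.le (-(a * (1 - θ)))
    exact mul_le_mul (Real.rpow_le_rpow_of_nonpos hX hxT (by nlinarith))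
      (Real.rpow_le_rpow_of_nonpos hY hyT (by nlinarith)) this (Real.rpow_nonneg hX.le _)
  calc betaWeight α u β v p * (1 - p.1 * p.2) ^ (-a)
      ≤ betaWeight α u β v p *
        ((1 - p.1) ^ (-(a * θ)) * (1 - p.2) ^ (-(a * (1 - θ)))) :=
        mul_le_mul_of_nonneg_left key (betaWeight_pos ⟨⟨hx0, hx1⟩, hy0, hy1⟩).le
    _ = betaWeight α (u - a * θ) β (v - a * (1 - θ)) p := by
        unfold betaWeight
        rw [show u - a * θ - 1 = u - 1 + -(a * θ) by ring,
          show v - a * (1 - θ) - 1 = v - 1 + -(a * (1 - θ)) by ring, Real.rpow_add hX,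
          Real.rpow_add hY]
        ring

/-- For `a > 0` the binomial coefficients are positive, so the series serves as its own majorant. -/
lemma hasSum_integral_rpow {α u β v a : ℝ} (hα : 0 < α) (hu : 0 < u) (hβ : 0 < β)
    (hv : 0 < v) (ha : 0 < a) (h : a < u + v) :
    HasSum (fun n : ℕ => rising a n / n.factorial * (beta (α + n) u * beta (β + n) v))
      (∫ p in unitSquare, betaWeight α u β v p * (1 - p.1 * p.2) ^ (-a)) := by
  have hs : ∀ t ∈ Ioo (0 : ℝ) 1,
      HasSum (fun n : ℕ => rising a n / n.factorial * t ^ n) ((1 - t) ^ (-a)) := fun t ht =>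
    hasSum_binomial a (by rw [abs_of_pos ht.1]; exact ht.2)
  refine hasSum_integral_betaWeight hα hu hβ hv (g := fun t => (1 - t) ^ (-a)) hs
    (D := fun t => (1 - t) ^ (-a)) (fun n t _ => le_of_eq ?_) hs
    (integrableOn_betaWeight_mul_rpow hα hu hβ hv ha h)
  rw [abs_of_pos (div_pos (rising_pos ha n) (by positivity))]

/-- The five linear forms of the parameters whose positivity matters for convergence. -/
lemma paramSet_pos {a₁ a₂ a₃ b₂ b₃ : ℝ} (hc : ∀ i, -1 < paramSet a₁ a₂ a₃ b₂ b₃ i) :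
    (0 < a₁ ∧ 0 < a₂ ∧ 0 < a₃) ∧ (0 < b₂ - a₁ ∧ 0 < b₂ - a₂ ∧ 0 < b₂ - a₃) ∧
      (0 < b₃ - a₁ ∧ 0 < b₃ - a₂ ∧ 0 < b₃ - a₃) ∧ 0 < b₂ + b₃ - a₁ - a₂ - a₃ := by
  have h0 := hc c00; have h1 := hc c11; have h2 := hc c12; have h3 := hc c13
  have h4 := hc c21; have h5 := hc c22; have h6 := hc c23
  have h7 := hc c31; have h8 := hc c32; have h9 := hc c33
  simp only [paramSet] at *
  refine ⟨⟨?_, ?_, ?_⟩, ⟨?_, ?_, ?_⟩, ⟨?_, ?_, ?_⟩, ?_⟩ <;> linarith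

lemma integrand_paramSet (a₁ a₂ a₃ b₂ b₃ : ℝ) {p : ℝ × ℝ} (hp : p ∈ unitSquare) :
    integrand (paramSet a₁ a₂ a₃ b₂ b₃) p =
      betaWeight a₂ (b₂ - a₂) a₃ (b₃ - a₃) p * (1 - p.1 * p.2) ^ (-a₁) := by
  have hm := mul_mem_Ioo_of_mem_unitSquare hp
  simp only [integrand, paramSet, betaWeight, sub_add_cancel]
  rw [Real.rpow_neg (sub_pos.2 hm.2).le]
  ring

lemma H_paramSet (a₁ a₂ a₃ b₂ b₃ : ℝ) :
    H (paramSet a₁ a₂ a₃ b₂ b₃) = ∫ p in unitSquare,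
      betaWeight a₂ (b₂ - a₂) a₃ (b₃ - a₃) p * (1 - p.1 * p.2) ^ (-a₁) :=
  setIntegral_congr_fun measurableSet_unitSquare fun _ hp => integrand_paramSet a₁ a₂ a₃ b₂ b₃ hp

/-- The inequality `a < u + v` required at the corner `(1, 1)` is here `c₀₀ > -1`. -/
lemma integrableOn_integrand {a₁ a₂ a₃ b₂ b₃ : ℝ} (hc : ∀ i, -1 < paramSet a₁ a₂ a₃ b₂ b₃ i) :
    IntegrableOn (integrand (paramSet a₁ a₂ a₃ b₂ b₃)) unitSquare := by
  obtain ⟨⟨h1, h2, h3⟩, ⟨-, h5, -⟩, ⟨-, -, h9⟩, h10⟩ := paramSet_pos hc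
  exact (integrableOn_congr_fun (fun _ hp => integrand_paramSet a₁ a₂ a₃ b₂ b₃ hp)
    measurableSet_unitSquare).2
    (integrableOn_betaWeight_mul_rpow h2 h5 h3 h9 h1 (by linarith))

lemma hasSum_term₃F₂ {a₁ a₂ a₃ b₂ b₃ : ℝ} (hc : ∀ i, -1 < paramSet a₁ a₂ a₃ b₂ b₃ i) :
    HasSum (term₃F₂ a₁ a₂ a₃ b₂ b₃) (H (paramSet a₁ a₂ a₃ b₂ b₃)) := by
  obtain ⟨⟨h1, h2, h3⟩, ⟨-, h5, -⟩, ⟨-, -, h9⟩, h10⟩ := paramSet_pos hc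
  rw [H_paramSet]
  refine (hasSum_integral_rpow h2 h5 h3 h9 h1 (by linarith)).congr_fun fun n => ?_
  rw [beta_add_natCast h2 h5, beta_add_natCast h3 h9]
  simp only [term₃F₂, hgCoeff, List.map_cons, List.map_nil, List.prod_cons, List.prod_nil,
    ← rising.eq_1, beta, add_sub_cancel]
  have := rising_pos (show 0 < b₂ by linarith) n
  have := rising_pos (show 0 < b₃ by linarith) n
  have := Real.Gamma_pos_of_pos (show 0 < b₂ by linarith)
  have := Real.Gamma_pos_of_pos (show 0 < b₃ by linarith)
  field_simp
  simp

/-! ### Invariance under permutations of the parameters -/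

/-- Division by `gammaProd` cancels the Gamma factors that distinguish `a₁` from `a₂, a₃` or pair
`aⱼ` with `bₗ`. The terms that remain are symmetric in `a₁, a₂, a₃` and in `b₂, b₃`. -/
lemma hasSum_H_div_gammaProd {a₁ a₂ a₃ b₂ b₃ : ℝ} (hc : ∀ i, -1 < paramSet a₁ a₂ a₃ b₂ b₃ i) :
    HasSum (fun n : ℕ => rising a₁ n * rising a₂ n * rising a₃ n /
        (n.factorial * rising b₂ n * rising b₃ n) /
        (Real.Gamma (b₂ + b₃ - (a₁ + a₂ + a₃)) * Real.Gamma b₂ * Real.Gamma b₃))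
      (H (paramSet a₁ a₂ a₃ b₂ b₃) / gammaProd (paramSet a₁ a₂ a₃ b₂ b₃)) := by
  obtain ⟨⟨h1, h2, h3⟩, ⟨-, h5, -⟩, ⟨-, -, h9⟩, h10⟩ := paramSet_pos hc
  refine ((hasSum_term₃F₂ hc).div_const _).congr_fun fun n => ?_
  simp only [term₃F₂, hgCoeff, List.map_cons, List.map_nil, List.prod_cons, List.prod_nil,
    ← rising.eq_1, gammaProd, paramSet, sub_add_cancel]
  have := rising_pos (show 0 < b₂ by linarith) n
  have := rising_pos (show 0 < b₃ by linarith) n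
  have := Real.Gamma_pos_of_pos (show 0 < b₂ by linarith)
  have := Real.Gamma_pos_of_pos (show 0 < b₃ by linarith)
  have := Real.Gamma_pos_of_pos h2
  have := Real.Gamma_pos_of_pos h3
  have := Real.Gamma_pos_of_pos h5
  have := Real.Gamma_pos_of_pos h9
  have := Real.Gamma_pos_of_pos (show 0 < b₂ + b₃ - (a₁ + a₂ + a₃) by linarith)
  field_simp
  simp

lemma H_div_gammaProd_swap_a₁ {a₁ a₂ a₃ b₂ b₃ : ℝ}
    (hc : ∀ i, -1 < paramSet a₁ a₂ a₃ b₂ b₃ i) (hc' : ∀ i, -1 < paramSet a₃ a₂ a₁ b₂ b₃ i) :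
    H (paramSet a₃ a₂ a₁ b₂ b₃) / gammaProd (paramSet a₃ a₂ a₁ b₂ b₃) =
      H (paramSet a₁ a₂ a₃ b₂ b₃) / gammaProd (paramSet a₁ a₂ a₃ b₂ b₃) := by
  refine (hasSum_H_div_gammaProd hc').unique ((hasSum_H_div_gammaProd hc).congr_fun fun n => ?_)
  rw [show a₃ + a₂ + a₁ = a₁ + a₂ + a₃ by ring]; ring

lemma H_div_gammaProd_swap_a₂ {a₁ a₂ a₃ b₂ b₃ : ℝ}
    (hc : ∀ i, -1 < paramSet a₁ a₂ a₃ b₂ b₃ i) (hc' : ∀ i, -1 < paramSet a₁ a₃ a₂ b₂ b₃ i) :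
    H (paramSet a₁ a₃ a₂ b₂ b₃) / gammaProd (paramSet a₁ a₃ a₂ b₂ b₃) =
      H (paramSet a₁ a₂ a₃ b₂ b₃) / gammaProd (paramSet a₁ a₂ a₃ b₂ b₃) := by
  refine (hasSum_H_div_gammaProd hc').unique ((hasSum_H_div_gammaProd hc).congr_fun fun n => ?_)
  rw [show a₁ + a₃ + a₂ = a₁ + a₂ + a₃ by ring]; ring

lemma H_div_gammaProd_swap_b {a₁ a₂ a₃ b₂ b₃ : ℝ}
    (hc : ∀ i, -1 < paramSet a₁ a₂ a₃ b₂ b₃ i) (hc' : ∀ i, -1 < paramSet a₁ a₂ a₃ b₃ b₂ i) :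
    H (paramSet a₁ a₂ a₃ b₃ b₂) / gammaProd (paramSet a₁ a₂ a₃ b₃ b₂) =
      H (paramSet a₁ a₂ a₃ b₂ b₃) / gammaProd (paramSet a₁ a₂ a₃ b₂ b₃) := by
  refine (hasSum_H_div_gammaProd hc').unique ((hasSum_H_div_gammaProd hc).congr_fun fun n => ?_)
  rw [add_comm b₃ b₂]; ring

/-- Change of variables on the unit interval. -/
lemma integral_Ioo_eq_of_bijOn {φ φ' : ℝ → ℝ} (hφ : BijOn φ (Ioo 0 1) (Ioo 0 1))
    (hd : ∀ x ∈ Ioo (0 : ℝ) 1, HasDerivAt φ (φ' x) x) (g : ℝ → ℝ) :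
    ∫ y in Ioo (0 : ℝ) 1, g y = ∫ x in Ioo (0 : ℝ) 1, |φ' x| * g (φ x) := by
  conv_lhs => rw [← hφ.image_eq]
  exact integral_image_eq_integral_abs_deriv_smul measurableSet_Ioo
    (fun x hx => (hd x hx).hasDerivWithinAt) hφ.injOn g

/-- Euler's transformation of the inner integral. -/
lemma integral_euler_transformation (a β v : ℝ) {x : ℝ} (hx : x ∈ Ioo (0 : ℝ) 1) :
    ∫ y in Ioo (0 : ℝ) 1, y ^ (β - 1) * (1 - y) ^ (v - 1) * (1 - x * y) ^ (-a) =
      (1 - x) ^ (v - a) *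
        ∫ t in Ioo (0 : ℝ) 1, t ^ (v - 1) * (1 - t) ^ (β - 1) * (1 - x * t) ^ (a - (β + v)) := by
  have hX : 0 < 1 - x := sub_pos.2 hx.2
  have hpos : ∀ t ∈ Ioo (0 : ℝ) 1, 0 < 1 - x * t := fun t ht => by nlinarith [hx.1, hx.2, ht.1, ht.2]
  have e1 : ∀ t ∈ Ioo (0 : ℝ) 1, 1 - (1 - t) / (1 - x * t) = t * (1 - x) / (1 - x * t) := fun t ht => by
    have := (hpos t ht).ne'
    rw [eq_div_iff this, sub_mul, div_mul_cancel₀ _ this]; ring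
  have e2 : ∀ t ∈ Ioo (0 : ℝ) 1, 1 - x * ((1 - t) / (1 - x * t)) = (1 - x) / (1 - x * t) :=
    fun t ht => by
      have := (hpos t ht).ne'
      rw [eq_div_iff this, sub_mul, mul_assoc, div_mul_cancel₀ _ this]; ring
  have hm : MapsTo (fun t => (1 - t) / (1 - x * t)) (Ioo 0 1) (Ioo 0 1) := fun t ht => by
    have h1 := hpos t ht
    refine ⟨div_pos (sub_pos.2 ht.2) h1, ?_⟩
    have h2 : 0 < t * (1 - x) / (1 - x * t) := div_pos (mul_pos ht.1 hX) h1
    rw [← e1 t ht] at h2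
    linarith
  -- The substitution `y = (1 - t) / (1 - x t)` is an involution of `(0, 1)`, so it serves as its
  -- own inverse.
  have hinv : LeftInvOn (fun t => (1 - t) / (1 - x * t)) (fun t => (1 - t) / (1 - x * t))
      (Ioo 0 1) := fun t ht => by
    simp only
    rw [e1 t ht, e2 t ht]
    rw [div_div_div_cancel_right₀ (hpos t ht).ne', mul_div_cancel_right₀ _ hX.ne']
  rw [integral_Ioo_eq_of_bijOn (φ := fun t => (1 - t) / (1 - x * t))
    (φ' := fun t => -(1 - x) / (1 - x * t) ^ 2) (InvOn.bijOn ⟨hinv, hinv⟩ hm hm),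
    ← integral_const_mul]
  · refine setIntegral_congr_fun measurableSet_Ioo fun t ht => ?_
    have h1 := hpos t ht
    have h2 : 0 < 1 - t := sub_pos.2 ht.2
    rw [e1 t ht, e2 t ht, abs_div, abs_neg, abs_of_pos hX, abs_of_pos (by positivity),
      Real.div_rpow h2.le h1.le, Real.div_rpow (mul_nonneg ht.1.le hX.le) h1.le,
      Real.div_rpow hX.le h1.le, Real.mul_rpow ht.1.le hX.le]
    have e3 : (1 - x) ^ (v - a) = (1 - x) * (1 - x) ^ (v - 1) * (1 - x) ^ (-a) := by
      rw [show v - a = 1 + (v - 1) + -a by ring, Real.rpow_add hX, Real.rpow_add hX, Real.rpow_one]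
    have e4 : (1 - x * t) ^ (a - (β + v)) = ((1 - x * t) ^ 2 * (1 - x * t) ^ (β - 1) *
        (1 - x * t) ^ (v - 1) * (1 - x * t) ^ (-a))⁻¹ := by
      rw [show a - (β + v) = -(((2 : ℕ) : ℝ) + (β - 1) + (v - 1) + -a) by push_cast; ring,
        Real.rpow_neg h1.le, Real.rpow_add h1, Real.rpow_add h1, Real.rpow_add h1,
        Real.rpow_natCast]
    rw [e3, e4]
    field_simp
  · intro t ht
    have h1 := (hpos t ht).ne'
    have := ((hasDerivAt_id t).const_sub 1).fun_div (((hasDerivAt_id t).const_mul x).const_sub 1) h1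
    convert! this using 1
    simp only [id]
    ring

/-- Fubini, then Euler's transformation in `y` for fixed `x`; the factor `(1 - x)^(b₃ - a₃ - a₁)`
that comes out shifts the exponent of `1 - x`, which changes `b₂` into `b₂ + b₃ - a₁ - a₃`. -/
lemma H_euler_transformation {a₁ a₂ a₃ b₂ b₃ : ℝ} (hc : ∀ i, -1 < paramSet a₁ a₂ a₃ b₂ b₃ i) :
    H (paramSet (b₃ - a₁) a₂ (b₃ - a₃) (b₂ + b₃ - a₁ - a₃) b₃) = H (paramSet a₁ a₂ a₃ b₂ b₃) := by
  obtain ⟨⟨h1, h2, h3⟩, ⟨-, h5, -⟩, ⟨h7, -, h9⟩, h10⟩ := paramSet_pos hc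
  have i1 := integrableOn_betaWeight_mul_rpow h2 h5 h3 h9 h1 (by linarith)
  have i2 := integrableOn_betaWeight_mul_rpow h2
    (show 0 < b₂ + b₃ - a₁ - a₃ - a₂ by linarith) h9
    (show 0 < b₃ - (b₃ - a₃) by linarith) h7 (by linarith)
  rw [H_paramSet, H_paramSet]
  rw [IntegrableOn, volume_restrict_unitSquare] at i1 i2
  rw [volume_restrict_unitSquare, integral_prod _ i1, integral_prod _ i2]
  refine setIntegral_congr_fun measurableSet_Ioo fun x hx => ?_
  have key := integral_euler_transformation a₁ a₃ (b₃ - a₃) hx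
  have hX : 0 < 1 - x := sub_pos.2 hx.2
  simp only [betaWeight, mul_assoc, integral_const_mul]
  simp only [mul_assoc] at key
  rw [key, show b₂ + b₃ - a₁ - a₃ - a₂ - 1 = b₂ - a₂ - 1 + (b₃ - a₃ - a₁) by ring, Real.rpow_add hX,
    show b₃ - (b₃ - a₃) = a₃ by ring, show -(b₃ - a₁) = a₁ - (a₃ + (b₃ - a₃)) by ring]
  simp only [mul_assoc]

/-! ### The group -/

instance : Fintype Idx :=
  ⟨{c00, c11, c12, c13, c21, c22, c23, c31, c32, c33}, fun i => by cases i <;> decide⟩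

/-- The labels as the two-element subsets of a five-element set. -/
def pair : Idx → Finset (Fin 5)
  | c00 => {0, 1}
  | c11 => {3, 4}
  | c12 => {0, 2}
  | c13 => {1, 2}
  | c21 => {2, 4}
  | c22 => {0, 3}
  | c23 => {1, 3}
  | c31 => {2, 3}
  | c32 => {0, 4}
  | c33 => {1, 4}

lemma pair_injective : Function.Injective pair := by decide

lemma card_pair (i : Idx) : (pair i).card = 2 := by revert i; decide

lemma exists_pair_eq {s : Finset (Fin 5)} (hs : s.card = 2) : ∃ i, pair i = s := by
  revert s; decide

/-- The label of a two-element set. -/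
noncomputable def label (s : {s : Finset (Fin 5) // s.card = 2}) : Idx :=
  (exists_pair_eq s.2).choose

lemma pair_label (s : {s : Finset (Fin 5) // s.card = 2}) : pair (label s) = s :=
  (exists_pair_eq s.2).choose_spec

/-- The action of the symmetric group of degree five on the labels. -/
noncomputable def symmHom : Equiv.Perm (Fin 5) →* Equiv.Perm Idx :=
  MonoidHom.toHomPerm
    { toFun := fun σ i => label ⟨(pair i).map σ.toEmbedding, by rw [Finset.card_map, card_pair]⟩
      map_one' := by
        funext i
        refine pair_injective ((pair_label _).trans ?_)
        exact Finset.map_refl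
      map_mul' := fun σ τ => by
        funext i
        refine pair_injective ((pair_label _).trans ?_)
        refine Eq.trans ?_ (pair_label _).symm
        simp only [pair_label]
        rw [Finset.map_map]
        rfl }

lemma pair_symmHom (σ : Equiv.Perm (Fin 5)) (i : Idx) :
    pair (symmHom σ i) = (pair i).map σ.toEmbedding :=
  pair_label _

lemma symmHom_eq_iff {σ : Equiv.Perm (Fin 5)} {τ : Equiv.Perm Idx} :
    symmHom σ = τ ↔ ∀ i, pair (τ i) = (pair i).map σ.toEmbedding := by
  refine ⟨fun h i => h ▸ pair_symmHom σ i, fun h => Equiv.ext fun i => pair_injective ?_⟩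
  rw [pair_symmHom, h]

/-- The labelling `pair` is arranged so that each of the four generators comes from a transposition.
-/
lemma symmHom_permA₁ : symmHom (Equiv.swap 2 4) = permA₁ := by
  rw [symmHom_eq_iff]; decide

lemma symmHom_permA₂ : symmHom (Equiv.swap 3 4) = permA₂ := by
  rw [symmHom_eq_iff]; decide

lemma symmHom_permB : symmHom (Equiv.swap 0 1) = permB := by
  rw [symmHom_eq_iff]; decide

lemma symmHom_permH : symmHom (Equiv.swap 1 3) = permH := by
  rw [symmHom_eq_iff]; decide

/-- A point is determined by the pairs containing it: it is the only element common to all of them.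
-/
lemma symmHom_injective : Function.Injective symmHom := by
  rw [injective_iff_map_eq_one]
  intro σ h
  rw [symmHom_eq_iff] at h
  have key : ∀ x y : Fin 5, (∀ i, x ∈ pair i → y ∈ pair i) → y = x := by decide
  refine Equiv.ext fun x => key x (σ x) fun i hi => ?_
  have h' : pair i = (pair i).map σ.toEmbedding := h i
  rw [h']
  exact Finset.mem_map_of_mem σ.toEmbedding hi

/-- The transpositions are the edges of a tree on the five points. It suffices to produce a 5-cycle,
which together with one transposition generates everything because 5 is prime. -/
lemma closure_swaps_eq_top :
    Subgroup.closure {Equiv.swap 2 4, Equiv.swap 3 4, Equiv.swap 0 1, Equiv.swap 1 3} =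
      (⊤ : Subgroup (Equiv.Perm (Fin 5))) := by
  set S : Subgroup (Equiv.Perm (Fin 5)) :=
    Subgroup.closure {Equiv.swap 2 4, Equiv.swap 3 4, Equiv.swap 0 1, Equiv.swap 1 3} with hS
  have m1 : Equiv.swap (2 : Fin 5) 4 ∈ S := Subgroup.subset_closure (by simp)
  have m2 : Equiv.swap (3 : Fin 5) 4 ∈ S := Subgroup.subset_closure (by simp)
  have m3 : Equiv.swap (0 : Fin 5) 1 ∈ S := Subgroup.subset_closure (by simp)
  have m4 : Equiv.swap (1 : Fin 5) 3 ∈ S := Subgroup.subset_closure (by simp)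
  have h5 : (Fintype.card (Fin 5)).Prime := by rw [Fintype.card_fin]; norm_num
  rw [eq_top_iff, ← Equiv.Perm.closure_prime_cycle_swap (σ := finRotate 5) (τ := Equiv.swap 0 1) h5
    isCycle_finRotate support_finRotate ⟨0, 1, by decide, rfl⟩, Subgroup.closure_le]
  rintro τ (rfl | rfl)
  · have m5 : Equiv.swap (2 : Fin 5) 3 ∈ S := by
      rw [show Equiv.swap (2 : Fin 5) 3 = Equiv.swap 2 4 * Equiv.swap 3 4 * Equiv.swap 2 4 by decide]
      exact mul_mem (mul_mem m1 m2) m1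
    -- The factorization is `(0 1)(1 2)(2 3)(3 4)`, with `(1 2)` written as a conjugate of `(2 3)`
    -- by `(1 3)`.
    have e : finRotate 5 = Equiv.swap 0 1 * (Equiv.swap 1 3 * Equiv.swap 2 3 * Equiv.swap 1 3) *
        Equiv.swap 2 3 * Equiv.swap 3 4 := by decide
    rw [e]
    exact mul_mem (mul_mem (mul_mem m3 (mul_mem (mul_mem m4 m5) m4)) m5) m2
  · exact m3

lemma range_symmHom : symmHom.range = permGroup := by
  rw [MonoidHom.range_eq_map, ← closure_swaps_eq_top, MonoidHom.map_closure, permGroup]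
  simp only [Set.image_insert_eq, Set.image_singleton, symmHom_permA₁, symmHom_permA₂,
    symmHom_permB, symmHom_permH]

lemma card_permGroup : Nat.card permGroup = 120 := by
  rw [← range_symmHom, ← Nat.card_congr (MonoidHom.ofInjective symmHom_injective).toEquiv,
    Nat.card_eq_fintype_card, Fintype.card_perm, Fintype.card_fin]
  rfl

/-! ### The action on the parameters -/

lemma act_mul (σ τ : Equiv.Perm Idx) (c : Idx → ℝ) : act (σ * τ) c = act σ (act τ c) := by
  funext i; simp [act]

lemma act_permA₁ (a₁ a₂ a₃ b₂ b₃ : ℝ) :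
    act permA₁ (paramSet a₁ a₂ a₃ b₂ b₃) = paramSet a₃ a₂ a₁ b₂ b₃ := by
  have h : permA₁⁻¹ = permA₁ := by decide
  funext i
  rw [act, h]
  cases i
  case c00 => exact show paramSet a₁ a₂ a₃ b₂ b₃ c00 = _ by simp only [paramSet]; ring
  all_goals rfl

lemma act_permA₂ (a₁ a₂ a₃ b₂ b₃ : ℝ) :
    act permA₂ (paramSet a₁ a₂ a₃ b₂ b₃) = paramSet a₁ a₃ a₂ b₂ b₃ := by
  have h : permA₂⁻¹ = permA₂ := by decide
  funext i
  rw [act, h]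
  cases i
  case c00 => exact show paramSet a₁ a₂ a₃ b₂ b₃ c00 = _ by simp only [paramSet]; ring
  all_goals rfl

lemma act_permB (a₁ a₂ a₃ b₂ b₃ : ℝ) :
    act permB (paramSet a₁ a₂ a₃ b₂ b₃) = paramSet a₁ a₂ a₃ b₃ b₂ := by
  have h : permB⁻¹ = permB := by decide
  funext i
  rw [act, h]
  cases i
  case c00 => exact show paramSet a₁ a₂ a₃ b₂ b₃ c00 = _ by simp only [paramSet]; ring
  all_goals rfl

lemma act_permH (a₁ a₂ a₃ b₂ b₃ : ℝ) :
    act permH (paramSet a₁ a₂ a₃ b₂ b₃) =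
      paramSet (b₃ - a₃) a₂ (b₃ - a₁) (b₂ + b₃ - a₁ - a₃) b₃ := by
  have h : permH⁻¹ = permH := by decide
  funext i
  rw [act, h]
  cases i
  case c00 => exact show paramSet a₁ a₂ a₃ b₂ b₃ c22 = _ by simp only [paramSet]; ring
  case c11 => exact show paramSet a₁ a₂ a₃ b₂ b₃ c33 = _ by simp only [paramSet]
  case c12 => exact show paramSet a₁ a₂ a₃ b₂ b₃ c12 = _ by simp only [paramSet]; ring
  case c13 => exact show paramSet a₁ a₂ a₃ b₂ b₃ c31 = _ by simp only [paramSet]; ring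
  case c21 => rfl
  case c22 => exact show paramSet a₁ a₂ a₃ b₂ b₃ c00 = _ by simp only [paramSet]; ring
  case c23 => rfl
  case c31 => exact show paramSet a₁ a₂ a₃ b₂ b₃ c13 = _ by simp only [paramSet]
  case c32 => exact show paramSet a₁ a₂ a₃ b₂ b₃ c32 = _ by simp only [paramSet]; ring
  case c33 => exact show paramSet a₁ a₂ a₃ b₂ b₃ c11 = _ by simp only [paramSet]; ring

lemma isParamSet_act_of_mem_generators {σ : Equiv.Perm Idx}
    (hσ : σ ∈ ({permA₁, permA₂, permB, permH} : Set (Equiv.Perm Idx))) {c : Idx → ℝ}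
    (hc : IsParamSet c) : IsParamSet (act σ c) := by
  obtain ⟨a₁, a₂, a₃, b₂, b₃, rfl⟩ := hc
  rcases hσ with rfl | rfl | rfl | rfl
  · exact ⟨_, _, _, _, _, act_permA₁ ..⟩
  · exact ⟨_, _, _, _, _, act_permA₂ ..⟩
  · exact ⟨_, _, _, _, _, act_permB ..⟩
  · exact ⟨_, _, _, _, _, act_permH ..⟩

lemma inv_eq_of_mem_generators {σ : Equiv.Perm Idx}
    (hσ : σ ∈ ({permA₁, permA₂, permB, permH} : Set (Equiv.Perm Idx))) : σ⁻¹ = σ := by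
  rcases hσ with rfl | rfl | rfl | rfl <;> decide

lemma isParamSet_act {σ : Equiv.Perm Idx} (hσ : σ ∈ permGroup) {c : Idx → ℝ}
    (hc : IsParamSet c) : IsParamSet (act σ c) := by
  revert c
  induction hσ using Subgroup.closure_induction'' with
  | mem σ hσ => exact fun hc => isParamSet_act_of_mem_generators hσ hc
  | inv_mem σ hσ =>
    rw [inv_eq_of_mem_generators hσ]
    exact fun hc => isParamSet_act_of_mem_generators hσ hc
  | one => exact fun hc => hc
  | mul σ τ _ _ h1 h2 => exact fun hc => act_mul σ τ _ ▸ h1 (h2 hc)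

lemma lt_act {c : Idx → ℝ} (hc : ∀ i, -1 < c i) (σ : Equiv.Perm Idx) (i : Idx) :
    -1 < act σ c i := hc _

lemma H_div_gammaProd_act_of_mem_generators {σ : Equiv.Perm Idx}
    (hσ : σ ∈ ({permA₁, permA₂, permB, permH} : Set (Equiv.Perm Idx))) {c : Idx → ℝ}
    (hc : IsParamSet c) (hpos : ∀ i, -1 < c i) :
    H (act σ c) / gammaProd (act σ c) = H c / gammaProd c := by
  have hpos' := lt_act hpos σ
  obtain ⟨a₁, a₂, a₃, b₂, b₃, rfl⟩ := hc
  rcases hσ with rfl | rfl | rfl | rfl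
  · rw [act_permA₁] at hpos' ⊢
    exact H_div_gammaProd_swap_a₁ hpos hpos'
  · rw [act_permA₂] at hpos' ⊢
    exact H_div_gammaProd_swap_a₂ hpos hpos'
  · rw [act_permB] at hpos' ⊢
    exact H_div_gammaProd_swap_b hpos hpos'
  -- Euler's transformation realizes `permA₁ * permH` and fixes `H` itself; the Gamma product is
  -- unchanged too, its factors being merely permuted.
  · have hpos₂ := lt_act hpos' permA₁
    rw [act_permH] at hpos' ⊢
    rw [act_permH, act_permA₁] at hpos₂
    rw [← H_div_gammaProd_swap_a₁ hpos' hpos₂, H_euler_transformation hpos]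
    congr 1
    simp only [gammaProd, paramSet, sub_add_cancel]
    rw [show b₂ + b₃ - a₁ - a₃ + b₃ - (b₃ - a₁ + a₂ + (b₃ - a₃)) = b₂ - a₂ by ring,
      show b₂ + b₃ - a₁ - a₃ - a₂ = b₂ + b₃ - (a₁ + a₂ + a₃) by ring,
      show b₃ - (b₃ - a₃) = a₃ by ring]
    ring

lemma H_div_gammaProd_act {σ : Equiv.Perm Idx} (hσ : σ ∈ permGroup) {c : Idx → ℝ}
    (hc : IsParamSet c) (hpos : ∀ i, -1 < c i) :
    H (act σ c) / gammaProd (act σ c) = H c / gammaProd c := by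
  revert c
  induction hσ using Subgroup.closure_induction'' with
  | mem σ hσ => exact fun hc hpos => H_div_gammaProd_act_of_mem_generators hσ hc hpos
  | inv_mem σ hσ =>
    rw [inv_eq_of_mem_generators hσ]
    exact fun hc hpos => H_div_gammaProd_act_of_mem_generators hσ hc hpos
  | one => exact fun _ _ => rfl
  | mul σ τ _ hτ h1 h2 =>
    intro c hc hpos
    rw [act_mul, h1 (isParamSet_act hτ hc) (lt_act hpos τ), h2 hc hpos]

/-! ### The Pfaff–Saalschütz sum -/

/-- This is a recurrence in `k`: the sum for `k + 1` at `(b, d)` reduces to the sum for `k` at `(b +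
1, d + 1)`. Stating it for partial sums with an explicit remainder makes it provable by induction on
`N`. -/
lemma sum_saalschutz_telescoping {b d : ℝ} (hb : 0 < b) (hd : 0 < d) (x : ℝ) (k N : ℕ) :
    ∑ n ∈ Finset.range (N + 1), (-1) ^ n * ((k + 1).choose n : ℝ) * rising (b + d - x + k) n *
        rising x n / (rising b n * rising d n) =
      (b - x) * (d - x) * ∑ n ∈ Finset.range (N + 1), (-1) ^ n * (k.choose n : ℝ) *
        rising (b + d - x + k + 1) n * rising x n / (rising b (n + 1) * rising d (n + 1)) +
      (-1) ^ N * (k.choose N : ℝ) * rising (b + d - x + k + 1) N * rising x N /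
        (rising b (N + 1) * rising d (N + 1)) * ((x + N) * (b + d - x + N)) := by
  induction N with
  | zero =>
    simp only [zero_add, Finset.sum_range_one, rising_zero, rising_succ]
    field_simp
    simp
    ring
  | succ N ih =>
    have hB := rising_pos hb (N + 1)
    have hD := rising_pos hd (N + 1)
    have hb' : 0 < b + (N + 1 : ℕ) := by positivity
    have hd' : 0 < d + (N + 1 : ℕ) := by positivity
    have hch : ((N : ℝ) + 1) * (k.choose (N + 1) : ℝ) = (k - N) * (k.choose N : ℝ) := by
      rcases le_or_gt N k with h | h
      · have := Nat.choose_succ_right_eq k N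
        rw [← Nat.cast_sub h, mul_comm, mul_comm (((k - N : ℕ) : ℝ))]
        exact_mod_cast this
      · simp [Nat.choose_eq_zero_of_lt h, Nat.choose_eq_zero_of_lt (Nat.lt_succ_of_lt h)]
    have hU : rising (b + d - x + k) (N + 1) =
        (b + d - x + k) * rising (b + d - x + k + 1) N := rising_succ' _ _
    rw [Finset.sum_range_succ, ih, Finset.sum_range_succ _ (N + 1), hU, Nat.choose_succ_succ,
      rising_succ (b + d - x + k + 1) N, rising_succ x N, rising_succ b (N + 1),
      rising_succ d (N + 1)]
    -- Pascal's rule splits the new summand: one part continues the sum on the right, the other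
    -- cancels the old remainder.
    have e : ((k.choose N : ℝ) + k.choose (N + 1)) * (b + d - x + k) =
        k.choose (N + 1) * (b + d - x + k + 1 + N) + k.choose N * (b + d - x + N) := by
      linear_combination -hch
    set A := (k.choose N : ℝ)
    set B := (k.choose (N + 1) : ℝ)
    set S := ∑ n ∈ Finset.range (N + 1), (-1) ^ n * (k.choose n : ℝ) *
        rising (b + d - x + k + 1) n * rising x n / (rising b (n + 1) * rising d (n + 1))
    set P := rising (b + d - x + k + 1) N
    set X := rising x N
    set V := rising b (N + 1)
    set W := rising d (N + 1)
    push_cast at hb' hd' ⊢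
    have e2 : (-1) ^ (N + 1) * B * (P * (b + d - x + k + 1 + N)) * (X * (x + N)) /
        (V * (b + (N + 1)) * (W * (d + (N + 1)))) * ((b + (N + 1)) * (d + (N + 1))) =
        (-1) ^ (N + 1) * B * (P * (b + d - x + k + 1 + N)) * (X * (x + N)) / (V * W) := by
      field_simp
    linear_combination (-1) ^ (N + 1) * P * X * (x + N) / (V * W) * e - e2

/-- The Pfaff–Saalschütz sum. -/
lemma sum_saalschutz {b d : ℝ} (hb : 0 < b) (hd : 0 < d) (x : ℝ) (k : ℕ) :
    ∑ n ∈ Finset.range (k + 1), (-1) ^ n * (k.choose n : ℝ) * rising (b + d - x - 1 + k) n *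
        rising x n / (rising b n * rising d n) =
      rising (b - x) k * rising (d - x) k / (rising b k * rising d k) := by
  induction k generalizing b d with
  | zero => simp
  | succ k ih =>
    have h := sum_saalschutz_telescoping hb hd x k (k + 1)
    have ih' := ih (show 0 < b + 1 by linarith) (show 0 < d + 1 by linarith)
    -- At `N = k + 1` the remainder carries the factor `k.choose (k + 1) = 0`.
    rw [Nat.choose_succ_self] at h
    simp only [Nat.cast_zero, mul_zero, zero_mul, zero_div, add_zero] at h
    rw [show b + d - x - 1 + ((k + 1 : ℕ) : ℝ) = b + d - x + k by push_cast; ring]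
    rw [show b + 1 + (d + 1) - x - 1 + (k : ℝ) = b + d - x + k + 1 by ring,
      show b + 1 - x = b - x + 1 by ring, show d + 1 - x = d - x + 1 by ring] at ih'
    rw [h, Finset.sum_range_succ, Nat.choose_succ_self]
    simp only [Nat.cast_zero, mul_zero, zero_mul, zero_div, add_zero]
    have e : ∀ n ∈ Finset.range (k + 1), (-1) ^ n * (k.choose n : ℝ) *
        rising (b + d - x + k + 1) n * rising x n / (rising b (n + 1) * rising d (n + 1)) =
        (b * d)⁻¹ * ((-1) ^ n * (k.choose n : ℝ) *
          rising (b + d - x + k + 1) n * rising x n / (rising (b + 1) n * rising (d + 1) n)) := by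
      intro n _
      rw [rising_succ', rising_succ']
      field_simp
    rw [Finset.sum_congr rfl e, ← Finset.mul_sum, ih', rising_succ' (b - x), rising_succ' (d - x),
      rising_succ' b, rising_succ' d]
    have := rising_pos (show 0 < b + 1 by linarith) k
    have := rising_pos (show 0 < d + 1 by linarith) k
    field_simp

/-! ### Very-well-poised coefficients -/

/-- The coefficients `(a)ₖ (1 + a/2)ₖ / ((a/2)ₖ k!)`, in a form that makes sense for `a = 0`. -/
noncomputable def vwpCoeff (a : ℝ) : ℕ → ℝ
  | 0 => 1
  | k + 1 => rising (a + 1) k * (a + 2 * (k + 1)) / (k + 1).factorial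

lemma vwpCoeff_pos {a : ℝ} (ha : 0 < a + 1) (k : ℕ) : 0 < vwpCoeff a k := by
  cases k with
  | zero => exact one_pos
  | succ k =>
    have := rising_pos ha k
    have : 0 < a + 2 * ((k : ℝ) + 1) := by nlinarith [(k.cast_nonneg : (0 : ℝ) ≤ k)]
    unfold vwpCoeff; positivity

lemma vwpCoeff_eq {a : ℝ} (ha : a ≠ 0) (k : ℕ) :
    vwpCoeff a k = rising a k * (a + 2 * k) / (a * k.factorial) := by
  cases k with
  | zero => simp [vwpCoeff, ha]
  | succ k => rw [vwpCoeff, rising_succ']; push_cast; field_simp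

/-- The coefficient is the sum of two adjacent binomial coefficients, because `(a + k) + k = a +
2k`; the factor `1 + w` adds exactly these. -/
lemma hasSum_vwpCoeff (a : ℝ) {w : ℝ} (hw : |w| < 1) :
    HasSum (fun k => vwpCoeff a k * w ^ k) ((1 + w) * (1 - w) ^ (-(a + 1))) := by
  have h := hasSum_binomial (a + 1) hw
  have h1 := (hasSum_nat_add_iff' 1).2 h
  rw [← hasSum_nat_add_iff' 1]
  have h2 := h1.add (h.mul_left w)
  simp only [Finset.sum_range_one, rising_zero, Nat.factorial_zero, Nat.cast_one, pow_zero] at h2 ⊢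
  rw [show (1 + w) * (1 - w) ^ (-(a + 1)) - vwpCoeff a 0 * 1 =
    (1 - w) ^ (-(a + 1)) - 1 / 1 * 1 + w * (1 - w) ^ (-(a + 1)) by simp [vwpCoeff]; ring]
  refine h2.congr_fun fun k => ?_
  rw [vwpCoeff, rising_succ, Nat.factorial_succ, pow_succ]
  push_cast
  field_simp
  ring

/-- The coefficients `vwpCoeff a k * (p)ₖ (q)ₖ / ((p + t)ₖ (q + t)ₖ)` with `a + 1 = p + q + t`. -/
noncomputable def poisedCoeff (p q t : ℝ) (k : ℕ) : ℝ :=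
  vwpCoeff (p + q + t - 1) k * (rising p k * rising q k / (rising (p + t) k * rising (q + t) k))

lemma poisedCoeff_pos {p q t : ℝ} (hp : 0 < p) (hq : 0 < q) (ht : 0 < t) (k : ℕ) :
    0 < poisedCoeff p q t k := by
  have := rising_pos hp k
  have := rising_pos hq k
  have := rising_pos (add_pos hp ht) k
  have := rising_pos (add_pos hq ht) k
  have := vwpCoeff_pos (show 0 < p + q + t - 1 + 1 by linarith) k
  unfold poisedCoeff; positivity

lemma poisedCoeff_le {p q t : ℝ} (hp : 0 < p) (hq : 0 < q) (ht : 0 < t) (k : ℕ) :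
    poisedCoeff p q t k ≤ vwpCoeff (p + q + t - 1) k := by
  have h1 := rising_pos hp k
  have h2 := rising_pos hq k
  have h3 := rising_pos (add_pos hp ht) k
  have h4 := rising_pos (add_pos hq ht) k
  refine mul_le_of_le_one_right
    (vwpCoeff_pos (show 0 < p + q + t - 1 + 1 by linarith) k).le ?_
  rw [div_le_one (mul_pos h3 h4)]
  exact mul_le_mul (rising_le_rising hp (by linarith) k) (rising_le_rising hq (by linarith) k)
    h2.le h3.le

/-- The sum of the power series with coefficients `poisedCoeff p q t`. -/
noncomputable def poisedSum (p q t w : ℝ) : ℝ := ∑' k, poisedCoeff p q t k * w ^ k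

lemma summable_poisedCoeff {p q t : ℝ} (hp : 0 < p) (hq : 0 < q) (ht : 0 < t) {w : ℝ}
    (hw : |w| < 1) : Summable fun k => |poisedCoeff p q t k * w ^ k| := by
  refine Summable.of_nonneg_of_le (fun k => abs_nonneg _) (fun k => ?_)
    (hasSum_vwpCoeff (p + q + t - 1) (w := |w|) (by rwa [abs_abs])).summable
  rw [abs_mul, abs_pow, abs_of_pos (poisedCoeff_pos hp hq ht k)]
  exact mul_le_mul_of_nonneg_right (poisedCoeff_le hp hq ht k) (by positivity)

lemma hasSum_poisedSum {p q t : ℝ} (hp : 0 < p) (hq : 0 < q) (ht : 0 < t) {w : ℝ}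
    (hw : |w| < 1) : HasSum (fun k => poisedCoeff p q t k * w ^ k) (poisedSum p q t w) :=
  (summable_poisedCoeff hp hq ht hw).of_abs.hasSum

/-- A power series converging on an open interval is analytic there. -/
lemma analyticOnNhd_tsum_of_summable {c : ℕ → ℝ} {R : ℝ}
    (h : ∀ x : ℝ, |x| < R → Summable fun n => |c n * x ^ n|) :
    AnalyticOnNhd ℝ (fun x => ∑' n, c n * x ^ n) (Metric.ball 0 R) := by
  set P := FormalMultilinearSeries.ofScalars ℝ c
  have hP : ∀ x, P.sum x = ∑' n, c n * x ^ n := fun x => by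
    simp only [FormalMultilinearSeries.sum, P, FormalMultilinearSeries.ofScalars_apply_eq,
      smul_eq_mul]
  intro x hx
  rw [mem_ball_zero_iff, Real.norm_eq_abs] at hx
  obtain ⟨r, hxr, hrR⟩ := exists_between hx
  have hr : 0 < r := (abs_nonneg x).trans_lt hxr
  have hrad : ENNReal.ofReal r ≤ P.radius := by
    refine FormalMultilinearSeries.le_radius_of_summable_norm P ?_
    refine (h r (by rwa [abs_of_pos hr])).congr fun n => ?_
    rw [FormalMultilinearSeries.ofScalars_norm, abs_mul, abs_pow, abs_of_pos hr, Real.norm_eq_abs,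
      Real.coe_toNNReal _ hr.le]
  have hpos : 0 < P.radius := (ENNReal.ofReal_pos.2 hr).trans_le hrad
  have := (P.hasFPowerSeriesOnBall hpos).analyticAt_of_mem (y := x) (by
    refine Metric.mem_eball.2 (lt_of_lt_of_le ?_ hrad)
    rw [edist_dist, Real.dist_eq, sub_zero]
    exact (ENNReal.ofReal_lt_ofReal_iff hr).2 hxr)
  exact this.congr (Eventually.of_forall hP)

lemma analyticOnNhd_poisedSum {p q t : ℝ} (hp : 0 < p) (hq : 0 < q) (ht : 0 < t) :
    AnalyticOnNhd ℝ (poisedSum p q t) (Metric.ball 0 1) :=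
  analyticOnNhd_tsum_of_summable fun _ hx => summable_poisedCoeff hp hq ht hx

/-! ### A quadratic transformation -/

/-- The coefficients of the quadratic transform of `poisedSum p q t`. -/
noncomputable def quadCoeff (p q t : ℝ) (n : ℕ) : ℝ :=
  rising (p + q + t) (2 * n) * rising t n / (n.factorial * (rising (p + t) n * rising (q + t) n))

lemma quadCoeff_pos {p q t : ℝ} (hp : 0 < p) (hq : 0 < q) (ht : 0 < t) (n : ℕ) :
    0 < quadCoeff p q t n := by
  have := rising_pos (show 0 < p + q + t by positivity) (2 * n)
  have := rising_pos ht n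
  have := rising_pos (add_pos hp ht) n
  have := rising_pos (add_pos hq ht) n
  unfold quadCoeff; positivity

lemma tendsto_add_mul_div_add (u c v : ℝ) :
    Tendsto (fun n : ℕ => (u + c * n) / (v + n)) atTop (𝓝 c) := by
  have h1 : Tendsto (fun n : ℕ => u / (n : ℝ) + c) atTop (𝓝 (0 + c)) :=
    (tendsto_const_div_atTop_nhds_zero_nat u).add_const c
  have h2 : Tendsto (fun n : ℕ => v / (n : ℝ) + 1) atTop (𝓝 (0 + 1)) :=
    (tendsto_const_div_atTop_nhds_zero_nat v).add_const 1
  have h3 := h1.div h2 (by norm_num)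
  rw [zero_add, zero_add, div_one] at h3
  refine h3.congr' ?_
  filter_upwards [eventually_gt_atTop 0] with n hn
  have hn' : (0 : ℝ) < n := by exact_mod_cast hn
  simp only [Pi.div_apply]
  rw [div_add' _ _ _ hn'.ne', div_add' _ _ _ hn'.ne', div_div_div_cancel_right₀ hn'.ne', one_mul]

lemma quadCoeff_succ {p q t : ℝ} (hp : 0 < p) (hq : 0 < q) (ht : 0 < t) (n : ℕ) :
    quadCoeff p q t (n + 1) = quadCoeff p q t n *
      ((p + q + t + 2 * n) / (1 + n) * ((p + q + t + 1 + 2 * n) / (p + t + n)) *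
        ((t + 1 * n) / (q + t + n))) := by
  have := rising_pos (add_pos hp ht) n
  have := rising_pos (add_pos hq ht) n
  unfold quadCoeff
  rw [show 2 * (n + 1) = 2 * n + 1 + 1 by ring, rising_succ, rising_succ, rising_succ, rising_succ,
    rising_succ, Nat.factorial_succ]
  push_cast
  field_simp
  ring

/-- Ratio test: because of the factor `rising (p + q + t) (2 * n)` the quotient of consecutive
coefficients tends to `2 * 2 * 1 = 4`. -/
lemma summable_quadCoeff {p q t : ℝ} (hp : 0 < p) (hq : 0 < q) (ht : 0 < t) {y : ℝ}
    (hy : |y| < 1 / 4) : Summable fun n => |quadCoeff p q t n * y ^ n| := by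
  rcases eq_or_ne y 0 with rfl | hy0
  · refine summable_of_ne_finset_zero (s := {0}) fun n hn => ?_
    rw [zero_pow (by simpa using hn)]; simp
  have hy0' : 0 < |y| := abs_pos.2 hy0
  have hlim := ((tendsto_add_mul_div_add (p + q + t) 2 1).mul
    (tendsto_add_mul_div_add (p + q + t + 1) 2 (p + t))).mul
    (tendsto_add_mul_div_add t 1 (q + t)) |>.mul_const |y|
  refine summable_of_ratio_test_tendsto_lt_one (l := 2 * 2 * 1 * |y|) (by linarith)
    (Eventually.of_forall fun n => ?_) (hlim.congr fun n => ?_)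
  · have := (quadCoeff_pos hp hq ht n).ne'
    positivity
  · have h := (quadCoeff_pos hp hq ht n)
    have h' := (quadCoeff_pos hp hq ht (n + 1))
    rw [Real.norm_eq_abs, Real.norm_eq_abs, abs_abs, abs_abs, abs_mul, abs_mul, abs_of_pos h,
      abs_of_pos h', abs_pow, abs_pow, quadCoeff_succ hp hq ht, pow_succ]
    field_simp

/-- With `A = p + q + t`, both `(A)₂ₙ (A + 2n)ⱼ₋₁` and `(A)ₘ (A + m)ₙ` equal `(A)ₘ₊ₙ` for `j ≥ 1`.
Hence on the antidiagonal `n + j = m + 1` the product is a factor independent of `n` times the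
Saalschütz summand up to sign. The case `j = 0` is separate because `vwpCoeff` is defined by cases.
-/
lemma quadCoeff_mul_vwpCoeff {p q t : ℝ} (hp : 0 < p) (hq : 0 < q) (ht : 0 < t) (m n j : ℕ)
    (h : n + j = m + 1) :
    quadCoeff p q t n * vwpCoeff (2 * n + (p + q + t - 1)) j =
      rising (p + q + t) m * (p + q + t - 1 + 2 * (m + 1)) / (m + 1).factorial *
        ((m + 1).choose n * rising (p + t + (q + t) - t - 1 + (m + 1 : ℕ)) n * rising t n /
          (rising (p + t) n * rising (q + t) n)) := by
  have := rising_pos (add_pos hp ht) n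
  have := rising_pos (add_pos hq ht) n
  have hch : ((m + 1).choose n : ℝ) = (m + 1).factorial / (n.factorial * j.factorial) := by
    rw [← h, Nat.choose_symm_add, Nat.add_choose]
    rw [Nat.cast_div (Nat.factorial_mul_factorial_dvd_factorial_add n j) (by positivity)]
    push_cast; rfl
  have hr : rising (p + t + (q + t) - t - 1 + (m + 1 : ℕ)) n = rising (p + q + t + m) n := by
    congr 1; push_cast; ring
  rw [hch, hr]
  cases j with
  | zero =>
    obtain rfl : n = m + 1 := by omega
    have e : rising (p + q + t) (2 * (m + 1)) = rising (p + q + t) m *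
        (p + q + t - 1 + 2 * (m + 1)) * rising (p + q + t + m) (m + 1) := by
      rw [show 2 * (m + 1) = (m + (m + 1)) + 1 by ring, rising_succ, rising_add]
      push_cast; ring
    rw [quadCoeff, e, vwpCoeff]
    simp only [Nat.factorial_zero, Nat.cast_one, mul_one]
    field_simp
  | succ j =>
    obtain rfl : m = n + j := by omega
    have e : rising (p + q + t) (2 * n) * rising (2 * n + (p + q + t - 1) + 1) j =
        rising (p + q + t) (n + j) * rising (p + q + t + (n + j : ℕ)) n := by
      rw [← rising_add, show n + j + n = 2 * n + j by ring, rising_add]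
      congr 2
      push_cast; ring
    rw [quadCoeff, vwpCoeff]
    have e' : (2 * (n : ℝ) + (p + q + t - 1) + 2 * ((j : ℝ) + 1)) =
      p + q + t - 1 + 2 * (((n + j : ℕ) : ℝ) + 1) := by push_cast; ring
    rw [e']
    field_simp
    linear_combination rising t n * (p + q + t - 1 + 2 * (((n + j : ℕ) : ℝ) + 1)) * e

/-- The quadratic transformation at the level of coefficients: Pfaff–Saalschütz with `b = p + t`, `d
= q + t`, `x = t`. -/
lemma sum_quadCoeff_mul_vwpCoeff {p q t : ℝ} (hp : 0 < p) (hq : 0 < q) (ht : 0 < t) (k : ℕ) :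
    ∑ x ∈ Finset.HasAntidiagonal.antidiagonal k,
      (-1) ^ x.1 * (quadCoeff p q t x.1 * vwpCoeff (2 * x.1 + (p + q + t - 1)) x.2) =
      poisedCoeff p q t k := by
  cases k with
  | zero => simp [quadCoeff, vwpCoeff, poisedCoeff]
  | succ m =>
    rw [Finset.sum_congr rfl (fun x hx => by
      rw [quadCoeff_mul_vwpCoeff hp hq ht m x.1 x.2 (Finset.HasAntidiagonal.mem_antidiagonal.1 hx)]),
      Finset.Nat.sum_antidiagonal_eq_sum_range_succ_mk]
    have h := sum_saalschutz (add_pos hp ht) (add_pos hq ht) t (m + 1)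
    rw [add_sub_cancel_right, add_sub_cancel_right] at h
    rw [poisedCoeff, vwpCoeff, ← h, Finset.mul_sum, sub_add_cancel]
    refine Finset.sum_congr rfl fun n _ => ?_
    ring

lemma rpow_neg_two_mul_add {x : ℝ} (hx : 0 < x) (n : ℕ) (a : ℝ) :
    x ^ (-(2 * (n : ℝ) + a)) = x ^ (-a) * ((x ^ 2)⁻¹) ^ n := by
  rw [neg_add, add_comm, Real.rpow_add hx, Real.rpow_neg hx.le (2 * (n : ℝ)),
    show (2 * (n : ℝ)) = ((2 * n : ℕ) : ℝ) by push_cast; ring, Real.rpow_natCast, inv_pow, pow_mul]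

/-- Expanding each `(1 - T)(1 + T)^(-(2n + p + q + t))` gives a double series, summed by rows on one
side and by antidiagonals on the other. Absolute convergence needs `|T| / (1 - |T|)² < 1/4`, which
the bound `1/10` guarantees. -/
lemma poisedSum_neg_eq_of_abs_lt {p q t : ℝ} (hp : 0 < p) (hq : 0 < q) (ht : 0 < t) {T : ℝ}
    (hT : |T| < 1 / 10) :
    poisedSum p q t (-T) = (1 - T) * (1 + T) ^ (-(p + q + t)) *
      ∑' n, quadCoeff p q t n * (T / (1 + T) ^ 2) ^ n := by
  have hT1 : |T| < 1 := by linarith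
  have hneg : |-T| < 1 := by rwa [abs_neg]
  have hTpos : 0 < 1 + T := by linarith [(abs_lt.1 hT1).1]
  have hTa : 0 < 1 - |T| := by linarith
  have hy : |(|T| / (1 - |T|) ^ 2)| < 1 / 4 := by
    rw [abs_of_nonneg (by positivity), div_lt_iff₀ (by positivity)]
    nlinarith [abs_nonneg T]
  set f : ℕ × ℕ → ℝ := fun x => quadCoeff p q t x.1 * T ^ x.1 *
    (vwpCoeff (2 * x.1 + (p + q + t - 1)) x.2 * (-T) ^ x.2) with hf
  have hpos : ∀ n : ℕ, 0 < 2 * (n : ℝ) + (p + q + t - 1) + 1 := fun n => by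
    have : (0 : ℝ) ≤ n := n.cast_nonneg
    linarith
  have hin : ∀ n, HasSum (fun j => |f (n, j)|) ((1 + |T|) * (1 - |T|) ^ (-(p + q + t)) *
      |quadCoeff p q t n * (|T| / (1 - |T|) ^ 2) ^ n|) := fun n => by
    have h := ((hasSum_vwpCoeff (2 * n + (p + q + t - 1)) (w := |T|)
      (by rwa [abs_abs])).mul_left (quadCoeff p q t n * |T| ^ n))
    rw [show 2 * (n : ℝ) + (p + q + t - 1) + 1 = 2 * n + (p + q + t) by ring,
      rpow_neg_two_mul_add hTa] at h
    have e : |quadCoeff p q t n * (|T| / (1 - |T|) ^ 2) ^ n| =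
        quadCoeff p q t n * |T| ^ n * (((1 - |T|) ^ 2)⁻¹) ^ n := by
      rw [abs_of_nonneg (mul_nonneg (quadCoeff_pos hp hq ht n).le (by positivity)), div_eq_mul_inv,
        mul_pow, mul_assoc]
    rw [e, show (1 + |T|) * (1 - |T|) ^ (-(p + q + t)) * (quadCoeff p q t n * |T| ^ n *
      (((1 - |T|) ^ 2)⁻¹) ^ n) = quadCoeff p q t n * |T| ^ n * ((1 + |T|) *
      ((1 - |T|) ^ (-(p + q + t)) * (((1 - |T|) ^ 2)⁻¹) ^ n)) by ring]
    refine h.congr_fun fun j => ?_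
    simp only [hf]
    rw [abs_mul, abs_mul, abs_mul, abs_pow, abs_pow, abs_neg,
      abs_of_pos (quadCoeff_pos hp hq ht n), abs_of_pos (vwpCoeff_pos (hpos n) j)]
  have hsum : Summable f := by
    refine Summable.of_abs ((summable_prod_of_nonneg fun _ => abs_nonneg _).2
      ⟨fun n => (hin n).summable, ?_⟩)
    simp only [fun n => (hin n).tsum_eq]
    exact (summable_quadCoeff hp hq ht hy).mul_left _
  have h1 : HasSum (fun n => (1 - T) * (1 + T) ^ (-(p + q + t)) *
      (quadCoeff p q t n * (T / (1 + T) ^ 2) ^ n)) (∑' x, f x) := by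
    refine hsum.hasSum.prod_fiberwise fun n => ?_
    have h := ((hasSum_vwpCoeff (2 * n + (p + q + t - 1)) hneg).mul_left (quadCoeff p q t n * T ^ n))
    rw [show 2 * (n : ℝ) + (p + q + t - 1) + 1 = 2 * n + (p + q + t) by ring, sub_neg_eq_add,
      rpow_neg_two_mul_add hTpos] at h
    convert! h using 1
    rw [div_eq_mul_inv, mul_pow]; ring
  have h2 : HasSum (fun k => poisedCoeff p q t k * (-T) ^ k) (∑' x, f x) := by
    have h := (Finset.HasAntidiagonal.sigmaAntidiagonalEquivProd.hasSum_iff.2 hsum.hasSum).sigma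
      fun k => hasSum_fintype _
    refine h.congr_fun fun k => ?_
    rw [← sum_quadCoeff_mul_vwpCoeff hp hq ht k, Finset.sum_mul]
    rw [← Finset.sum_coe_sort]
    refine Finset.sum_congr rfl fun x _ => ?_
    have hx := Finset.HasAntidiagonal.mem_antidiagonal.1 x.2
    simp only [hf, Function.comp, Finset.HasAntidiagonal.sigmaAntidiagonalEquivProd_apply]
    have e1 : (-T) ^ k = (-1) ^ x.1.1 * T ^ x.1.1 * (-T) ^ x.1.2 := by
      rw [← neg_pow, ← pow_add, hx]
    have e2 : (-1 : ℝ) ^ x.1.1 * (-1) ^ x.1.1 = 1 := by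
      rw [← pow_add, ← two_mul]; exact Even.neg_one_pow (even_two_mul x.1.1)
    rw [e1]
    linear_combination (quadCoeff p q t x.1.1 * vwpCoeff (2 * x.1.1 + (p + q + t - 1)) x.1.2 *
      T ^ x.1.1 * (-T) ^ x.1.2) * e2
  rw [← tsum_mul_left, h1.tsum_eq]
  exact h2.tsum_eq

lemma abs_div_one_add_sq_lt {T : ℝ} (hT : T ∈ Ioo (-1 / 10 : ℝ) 1) : |T / (1 + T) ^ 2| < 1 / 4 := by
  have h : 0 < 1 + T := by linarith [hT.1]
  rw [abs_lt, lt_div_iff₀ (by positivity), div_lt_iff₀ (by positivity)]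
  constructor
  · nlinarith [hT.1, hT.2]
  · nlinarith [hT.1, hT.2, mul_pos (sub_pos.2 hT.2) (sub_pos.2 hT.2)]

/-- The quadratic transformation of the very-well-poised series. -/
lemma poisedSum_neg_eq {p q t : ℝ} (hp : 0 < p) (hq : 0 < q) (ht : 0 < t) {T : ℝ}
    (hT : T ∈ Ioo (-1 / 10 : ℝ) 1) :
    poisedSum p q t (-T) = (1 - T) * (1 + T) ^ (-(p + q + t)) *
      ∑' n, quadCoeff p q t n * (T / (1 + T) ^ 2) ^ n := by
  have hQ : AnalyticOnNhd ℝ (fun y => ∑' n, quadCoeff p q t n * y ^ n) (Metric.ball 0 (1 / 4)) :=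
    analyticOnNhd_tsum_of_summable fun _ hy => summable_quadCoeff hp hq ht hy
  have hpos : ∀ x ∈ Ioo (-1 / 10 : ℝ) 1, 0 < 1 + x := fun x hx => by linarith [hx.1]
  have h1 : AnalyticOnNhd ℝ (fun x => poisedSum p q t (-x)) (Ioo (-1 / 10 : ℝ) 1) := fun x hx =>
    (analyticOnNhd_poisedSum hp hq ht (-x) (by
      rw [mem_ball_zero_iff, Real.norm_eq_abs, abs_lt]; constructor <;> linarith [hx.1, hx.2])).fun_comp
      analyticAt_id.neg
  have h2 : AnalyticOnNhd ℝ (fun x => (1 - x) * (1 + x) ^ (-(p + q + t)) *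
      ∑' n, quadCoeff p q t n * (x / (1 + x) ^ 2) ^ n) (Ioo (-1 / 10 : ℝ) 1) := fun x hx => by
    have e1 : AnalyticAt ℝ (fun x : ℝ => 1 + x) x := analyticAt_const.add analyticAt_id
    have e2 : AnalyticAt ℝ (fun x : ℝ => 1 - x) x := analyticAt_const.sub analyticAt_id
    have e3 : AnalyticAt ℝ (fun x : ℝ => (1 + x) ^ (-(p + q + t))) x := by
      refine ((e1.log (hpos x hx)).mul (analyticAt_const (v := -(p + q + t)))).rexp'.congr ?_
      filter_upwards [Ioo_mem_nhds hx.1 hx.2] with y hy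
      exact (Real.rpow_def_of_pos (hpos y hy) _).symm
    have e4 : AnalyticAt ℝ (fun x : ℝ => x / (1 + x) ^ 2) x :=
      analyticAt_id.div (e1.pow 2) (pow_pos (hpos x hx) 2).ne'
    refine (e2.mul e3).mul ((hQ _ ?_).fun_comp e4)
    rw [mem_ball_zero_iff, Real.norm_eq_abs]
    exact abs_div_one_add_sq_lt hx
  -- Both sides are analytic on the interval and agree near `0`, so the identity theorem extends the
  -- equality up to `T = 1`. The left endpoint is negative so that `0` is interior.
  refine h1.eqOn_of_preconnected_of_eventuallyEq h2 isPreconnected_Ioo (z₀ := 0) (by norm_num) ?_ hT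
  filter_upwards [Metric.ball_mem_nhds (0 : ℝ) (show (0 : ℝ) < 1 / 10 by norm_num)] with x hx
  rw [mem_ball_zero_iff, Real.norm_eq_abs] at hx
  exact poisedSum_neg_eq_of_abs_lt hp hq ht hx

lemma hasSum_quadCoeff {p q t : ℝ} (hp : 0 < p) (hq : 0 < q) (ht : 0 < t) {T : ℝ}
    (hT : T ∈ Ioo (0 : ℝ) 1) :
    HasSum (fun n : ℕ => quadCoeff p q t n *
      (T ^ n * ((1 - T) * (1 + T) ^ (-(2 * (n : ℝ) + (p + q + t)))))) (poisedSum p q t (-T)) := by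
  have hT' : T ∈ Ioo (-1 / 10 : ℝ) 1 := ⟨by linarith [hT.1], hT.2⟩
  have hpos : 0 < 1 + T := by linarith [hT.1]
  rw [poisedSum_neg_eq hp hq ht hT']
  refine ((summable_quadCoeff hp hq ht (abs_div_one_add_sq_lt hT')).of_abs.hasSum.mul_left
    _).congr_fun fun n => ?_
  rw [rpow_neg_two_mul_add hpos, div_eq_mul_inv, mul_pow]
  ring

/-! ### A Dirichlet-type integral over the unit square -/

lemma lintegral_Ioo_eq_of_bijOn {φ φ' : ℝ → ℝ} (hφ : BijOn φ (Ioo 0 1) (Ioo 0 1))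
    (hd : ∀ x ∈ Ioo (0 : ℝ) 1, HasDerivAt φ (φ' x) x) (g : ℝ → ENNReal) :
    ∫⁻ y in Ioo (0 : ℝ) 1, g y = ∫⁻ x in Ioo (0 : ℝ) 1, ENNReal.ofReal |φ' x| * g (φ x) := by
  conv_lhs => rw [← hφ.image_eq]
  exact lintegral_image_eq_lintegral_abs_deriv_mul measurableSet_Ioo
    (fun x hx => (hd x hx).hasDerivWithinAt) hφ.injOn g

/-- The substitution `y = q (1 - x) / (1 - q x)`. -/
lemma lintegral_Ioo_moebius {x : ℝ} (hx : x ∈ Ioo (0 : ℝ) 1) (g : ℝ → ENNReal) :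
    ∫⁻ y in Ioo (0 : ℝ) 1, g y = ∫⁻ q in Ioo (0 : ℝ) 1,
      ENNReal.ofReal ((1 - x) / (1 - q * x) ^ 2) * g (q * (1 - x) / (1 - q * x)) := by
  have hX : 0 < 1 - x := sub_pos.2 hx.2
  have hq : ∀ q ∈ Ioo (0 : ℝ) 1, 0 < 1 - q * x := fun q hq => by nlinarith [hx.1, hx.2, hq.1, hq.2]
  have hy : ∀ y ∈ Ioo (0 : ℝ) 1, 0 < 1 - x + x * y := fun y hy => by
    have := mul_pos hx.1 hy.1; linarith
  have hbij : BijOn (fun q => q * (1 - x) / (1 - q * x)) (Ioo 0 1) (Ioo 0 1) := by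
    refine InvOn.bijOn (f' := fun y => y / (1 - x + x * y)) ⟨fun q hq' => ?_, fun y hy' => ?_⟩
      (fun q hq' => ?_) (fun y hy' => ?_)
    · have h := hq q hq'
      simp only
      have e : 1 - x + x * (q * (1 - x) / (1 - q * x)) = (1 - x) / (1 - q * x) := by
        rw [eq_div_iff h.ne', add_mul, mul_assoc x, div_mul_cancel₀ _ h.ne']; ring
      rw [e, div_div_div_cancel_right₀ h.ne', mul_div_cancel_right₀ _ hX.ne']
    · have h := hy y hy'
      simp only
      have e : 1 - y / (1 - x + x * y) * x = (1 - x) / (1 - x + x * y) := by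
        rw [eq_div_iff h.ne', sub_mul, mul_right_comm, div_mul_cancel₀ _ h.ne']; ring
      rw [e, div_mul_eq_mul_div, div_div_div_cancel_right₀ h.ne', mul_div_cancel_right₀ _ hX.ne']
    · have h := hq q hq'
      refine ⟨div_pos (mul_pos hq'.1 hX) h, ?_⟩
      rw [div_lt_one h]
      linarith [hq'.2]
    · have h := hy y hy'
      refine ⟨div_pos hy'.1 h, ?_⟩
      rw [div_lt_one h]
      nlinarith [hy'.2]
  rw [lintegral_Ioo_eq_of_bijOn hbij (φ' := fun q => (1 - x) / (1 - q * x) ^ 2)]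
  · refine setLIntegral_congr_fun measurableSet_Ioo fun q hq' => ?_
    have := hq q hq'
    rw [abs_of_pos (by positivity)]
  · intro q hq'
    have h := (hq q hq').ne'
    have := ((hasDerivAt_id q).mul_const (1 - x)).fun_div
      (((hasDerivAt_id q).mul_const x).const_sub 1) h
    convert! this using 1
    simp only [id]
    ring

/-- The substitution `u = x (1 - q x) / (1 - q x²)`. -/
lemma lintegral_Ioo_quadratic {q : ℝ} (hq : q ∈ Ioo (0 : ℝ) 1) (g : ℝ → ENNReal) :
    ∫⁻ u in Ioo (0 : ℝ) 1, g u = ∫⁻ x in Ioo (0 : ℝ) 1,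
      ENNReal.ofReal ((1 - 2 * q * x + q * x ^ 2) / (1 - q * x ^ 2) ^ 2) *
        g (x * (1 - q * x) / (1 - q * x ^ 2)) := by
  set φ : ℝ → ℝ := fun x => x * (1 - q * x) / (1 - q * x ^ 2) with hφ
  have hQ : 0 < 1 - q := sub_pos.2 hq.2
  have hden : ∀ x ∈ Icc (0 : ℝ) 1, 0 < 1 - q * x ^ 2 := fun x hx => by
    have : x ^ 2 ≤ 1 := pow_le_one₀ hx.1 hx.2
    nlinarith [hq.1]
  -- The expression equals `(1 - q) + q (1 - x)²`.
  have hnum : ∀ x : ℝ, 0 < 1 - 2 * q * x + q * x ^ 2 := fun x => by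
    nlinarith [mul_nonneg hq.1.le (sq_nonneg (1 - x))]
  have hd : ∀ x ∈ Icc (0 : ℝ) 1,
      HasDerivAt φ ((1 - 2 * q * x + q * x ^ 2) / (1 - q * x ^ 2) ^ 2) x := fun x hx => by
    have h := (hden x hx).ne'
    have := ((hasDerivAt_id x).fun_mul (((hasDerivAt_id x).const_mul q).const_sub 1)).fun_div
      ((((hasDerivAt_id x).fun_pow 2).const_mul q).const_sub 1) h
    convert! this using 1
    simp only [id]
    congr 1
    push_cast
    ring
  have hcont : ContinuousOn φ (Icc 0 1) := fun x hx => (hd x hx).continuousAt.continuousWithinAt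
  have hmono : StrictMonoOn φ (Icc 0 1) := by
    refine strictMonoOn_of_deriv_pos (convex_Icc 0 1) hcont fun x hx => ?_
    rw [interior_Icc] at hx
    rw [(hd x (Ioo_subset_Icc_self hx)).deriv]
    exact div_pos (hnum x) (pow_pos (hden x (Ioo_subset_Icc_self hx)) 2)
  have h0 : φ 0 = 0 := by simp [hφ]
  have h1 : φ 1 = 1 := by simp [hφ, hQ.ne']
  -- Inverting `φ` would involve a square root; strict monotonicity and the intermediate value
  -- theorem avoid this.
  have hbij : BijOn φ (Ioo 0 1) (Ioo 0 1) := by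
    refine ⟨fun x hx => ?_, (hmono.mono Ioo_subset_Icc_self).injOn, ?_⟩
    · have hx' := Ioo_subset_Icc_self hx
      exact ⟨h0 ▸ hmono (by simp) hx' hx.1, h1 ▸ hmono hx' (by simp) hx.2⟩
    · have := intermediate_value_Ioo zero_le_one hcont
      rwa [h0, h1] at this
  rw [lintegral_Ioo_eq_of_bijOn hbij fun x hx => hd x (Ioo_subset_Icc_self hx)]
  refine setLIntegral_congr_fun measurableSet_Ioo fun x hx => ?_
  rw [abs_of_pos (div_pos (hnum x) (pow_pos (hden x (Ioo_subset_Icc_self hx)) 2))]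

/-- With `y = q (1 - x) / (1 - q x)` and `u = x / (1 + x y)` one has `u = x (1 - q x) / (1 - q x²)`
and `y / (1 + x y) = q (1 - u)`. So `(u, q)` are coordinates on the Dirichlet triangle, and the two
sides are the same density written in `(x, q)`. -/
lemma betaWeight_mul_eq {α β s x q : ℝ} (hx : x ∈ Ioo (0 : ℝ) 1) (hq : q ∈ Ioo (0 : ℝ) 1) :
    (1 - x) / (1 - q * x) ^ 2 *
      (betaWeight α s β s (x, q * (1 - x) / (1 - q * x)) *
        ((1 - x * (q * (1 - x) / (1 - q * x))) *
          (1 + x * (q * (1 - x) / (1 - q * x))) ^ (-(α + β + s)))) =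
    (1 - 2 * q * x + q * x ^ 2) / (1 - q * x ^ 2) ^ 2 *
      betaWeight α (β + s) β s (x * (1 - q * x) / (1 - q * x ^ 2), q) := by
  have hX : 0 < 1 - x := sub_pos.2 hx.2
  have hQ : 0 < 1 - q := sub_pos.2 hq.2
  have hA : 0 < 1 - q * x := by nlinarith [hx.1, hx.2, hq.1, hq.2]
  have hB : 0 < 1 - q * x ^ 2 := by
    have : x ^ 2 ≤ 1 := pow_le_one₀ hx.1.le hx.2.le
    nlinarith [hq.1]
  have e1 : 1 - q * (1 - x) / (1 - q * x) = (1 - q) / (1 - q * x) := by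
    rw [eq_div_iff hA.ne', sub_mul, div_mul_cancel₀ _ hA.ne']; ring
  have e2 : 1 - x * (q * (1 - x) / (1 - q * x)) = (1 - 2 * q * x + q * x ^ 2) / (1 - q * x) := by
    rw [eq_div_iff hA.ne', sub_mul, mul_assoc x, div_mul_cancel₀ _ hA.ne']; ring
  have e3 : 1 + x * (q * (1 - x) / (1 - q * x)) = (1 - q * x ^ 2) / (1 - q * x) := by
    rw [eq_div_iff hA.ne', add_mul, mul_assoc x, div_mul_cancel₀ _ hA.ne']; ring
  have e4 : 1 - x * (1 - q * x) / (1 - q * x ^ 2) = (1 - x) / (1 - q * x ^ 2) := by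
    rw [eq_div_iff hB.ne', sub_mul, div_mul_cancel₀ _ hB.ne']; ring
  simp only [betaWeight]
  rw [e1, e2, e3, e4, Real.div_rpow (mul_nonneg hq.1.le hX.le) hA.le, Real.div_rpow hQ.le hA.le,
    Real.div_rpow hB.le hA.le, Real.div_rpow (mul_nonneg hx.1.le hA.le) hB.le,
    Real.div_rpow hX.le hB.le, Real.mul_rpow hq.1.le hX.le, Real.mul_rpow hx.1.le hA.le]
  have f : ∀ {z : ℝ}, 0 < z → z ^ (-(α + β + s)) =
      (z ^ (α - 1) * z ^ (β - 1) * z ^ (s - 1) * z ^ 3)⁻¹ := fun {z} hz => by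
    rw [← Real.rpow_natCast, ← Real.rpow_add hz, ← Real.rpow_add hz, ← Real.rpow_add hz,
      ← Real.rpow_neg hz.le]
    congr 1; push_cast; ring
  have g : ∀ {z : ℝ}, 0 < z → z ^ (β + s - 1) = z ^ (β - 1) * z ^ (s - 1) * z := fun {z} hz => by
    rw [show β + s - 1 = β - 1 + (s - 1) + 1 by ring, Real.rpow_add_one hz.ne', Real.rpow_add hz]
  rw [f hA, f hB, g hX, g hB]
  have p1 := (Real.rpow_pos_of_pos hA (α - 1)).ne'
  have p2 := (Real.rpow_pos_of_pos hA (β - 1)).ne'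
  have p3 := (Real.rpow_pos_of_pos hA (s - 1)).ne'
  have p4 := (Real.rpow_pos_of_pos hB (α - 1)).ne'
  have p5 := (Real.rpow_pos_of_pos hB (β - 1)).ne'
  have p6 := (Real.rpow_pos_of_pos hB (s - 1)).ne'
  have hA' := hA.ne'
  have hB' := hB.ne'
  -- Once all powers and polynomials are replaced by atoms, only an identity of rational expressions
  -- is left.
  clear hA hB e1 e2 e3 e4 f g
  generalize (1 - q * x) ^ (α - 1) = A1 at *
  generalize (1 - q * x) ^ (β - 1) = A2 at *
  generalize (1 - q * x) ^ (s - 1) = A3 at *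
  generalize (1 - q * x ^ 2) ^ (α - 1) = B1 at *
  generalize (1 - q * x ^ 2) ^ (β - 1) = B2 at *
  generalize (1 - q * x ^ 2) ^ (s - 1) = B3 at *
  generalize (1 - x) ^ (β - 1) = X2
  generalize (1 - x) ^ (s - 1) = X3
  generalize (1 - q) ^ (s - 1) = Q3
  generalize x ^ (α - 1) = x1
  generalize q ^ (β - 1) = q1
  generalize 1 - 2 * q * x + q * x ^ 2 = D
  generalize 1 - q * x = A at *
  generalize 1 - q * x ^ 2 = B at *
  field_simp

/-- The change of variables `u = x / (1 + x y)`, `v = y / (1 + x y)` evaluates this integral as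
a Dirichlet integral over a triangle. -/
lemma integral_betaWeight_mul_rpow {α β s : ℝ} (hα : 0 < α) (hβ : 0 < β) (hs : 0 < s) :
    ∫ p in unitSquare, betaWeight α s β s p *
      ((1 - p.1 * p.2) * (1 + p.1 * p.2) ^ (-(α + β + s))) = beta α (β + s) * beta β s := by
  rw [← integral_betaWeight hα (add_pos hβ hs) hβ hs]
  have hnn : ∀ p ∈ unitSquare, 0 ≤ betaWeight α s β s p *
      ((1 - p.1 * p.2) * (1 + p.1 * p.2) ^ (-(α + β + s))) := fun p hp => by
    have h := mul_mem_Ioo_of_mem_unitSquare hp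
    exact mul_nonneg (betaWeight_pos hp).le (mul_nonneg (sub_nonneg.2 h.2.le)
      (Real.rpow_nonneg (by linarith [h.1]) _))
  -- Both integrands are nonnegative; with `∫⁻` the order of integration may be exchanged without
  -- any integrability check.
  rw [integral_eq_lintegral_of_nonneg_ae ((ae_restrict_mem measurableSet_unitSquare).mono hnn)
      (by fun_prop),
    integral_eq_lintegral_of_nonneg_ae ((ae_restrict_mem measurableSet_unitSquare).mono
      fun p hp => (betaWeight_pos hp).le) (by fun_prop)]
  congr 1
  rw [volume_restrict_unitSquare, lintegral_prod _ (by fun_prop),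
    lintegral_prod_symm _ (by fun_prop)]
  have step : ∀ x ∈ Ioo (0 : ℝ) 1, ∫⁻ y in Ioo (0 : ℝ) 1, ENNReal.ofReal (betaWeight α s β s (x, y) *
      ((1 - x * y) * (1 + x * y) ^ (-(α + β + s)))) = ∫⁻ q in Ioo (0 : ℝ) 1, ENNReal.ofReal
        ((1 - 2 * q * x + q * x ^ 2) / (1 - q * x ^ 2) ^ 2 *
          betaWeight α (β + s) β s (x * (1 - q * x) / (1 - q * x ^ 2), q)) := fun x hx => by
    rw [lintegral_Ioo_moebius hx]
    refine setLIntegral_congr_fun measurableSet_Ioo fun q hq => ?_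
    have hX : 0 < 1 - x := sub_pos.2 hx.2
    rw [← ENNReal.ofReal_mul (by positivity), betaWeight_mul_eq hx hq]
  rw [setLIntegral_congr_fun measurableSet_Ioo step, lintegral_lintegral_swap (by fun_prop)]
  refine setLIntegral_congr_fun measurableSet_Ioo fun q hq => ?_
  refine Eq.trans (setLIntegral_congr_fun measurableSet_Ioo fun x hx => ?_)
    (lintegral_Ioo_quadratic hq fun u => ENNReal.ofReal (betaWeight α (β + s) β s (u, q))).symm
  have h : 0 ≤ 1 - 2 * q * x + q * x ^ 2 := by
    nlinarith [mul_nonneg hq.1.le (sq_nonneg (1 - x)), hq.2]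
  rw [← ENNReal.ofReal_mul (by positivity)]

/-! ### The very-well-poised `₆F₅`-series -/

/-- Beta integration adjoins the upper parameters `α, β` and the lower ones `α + s, β + s`. It is
used twice: to build `poisedSum` from an elementary function, and to build the `₆F₅`-series from
`poisedSum`. -/
lemma hasSum_poised_integral {α β s : ℝ} (hα : 0 < α) (hβ : 0 < β) (hs : 0 < s) {d : ℕ → ℝ}
    {g : ℝ → ℝ} {w : ℝ} (hd : Summable fun k => |d k * w ^ k|)
    (hg : ∀ t ∈ Ioo (0 : ℝ) 1, HasSum (fun k => d k * (w * t) ^ k) (g (w * t))) :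
    HasSum (fun k => d k * (rising α k * rising β k / (rising (α + s) k * rising (β + s) k)) * w ^ k)
      ((beta α s * beta β s)⁻¹ *
        ∫ p in unitSquare, betaWeight α s β s p * g (w * (p.1 * p.2))) := by
  have h := hasSum_integral_betaWeight hα hs hβ hs (d := fun k => d k * w ^ k)
    (g := fun t => g (w * t)) (D := fun _ => ∑' k, |d k * w ^ k|) (m := fun k _ => |d k * w ^ k|)
    (fun t ht => (hg t ht).congr_fun fun k => by rw [mul_pow, mul_assoc])
    (fun k t ht => mul_le_of_le_one_right (abs_nonneg _) (pow_le_one₀ ht.1.le ht.2.le))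
    (fun t ht => hd.hasSum) ((integrableOn_betaWeight hα hs hβ hs).mul_const _)
  refine (h.mul_left _).congr_fun fun k => ?_
  have h1 := ProbabilityTheory.beta_pos hα hs
  have h2 := ProbabilityTheory.beta_pos hβ hs
  have h3 := rising_pos (add_pos hα hs) k
  have h4 := rising_pos (add_pos hβ hs) k
  rw [beta_add_natCast hα hs, beta_add_natCast hβ hs]
  field_simp

/-- `poisedSum` at `-T` is an average, over a product of beta distributions, of `(1 - y)(1 + y)^(-(p
+ q + t))` with `0 ≤ y < 1`, whose values lie in `[0, 1]`. The bound is uniform up to `T = 1`, as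
the Abel limit requires. -/
lemma abs_poisedSum_neg_le {p q t : ℝ} (hp : 0 < p) (hq : 0 < q) (ht : 0 < t) {T : ℝ}
    (hT0 : 0 ≤ T) (hT1 : T < 1) : |poisedSum p q t (-T)| ≤ 1 := by
  have hT : |-T| < 1 := by rwa [abs_neg, abs_of_nonneg hT0]
  have hle : ∀ x ∈ Ioo (0 : ℝ) 1, T * x ≤ T ∧ 0 ≤ T * x := fun x hx =>
    ⟨mul_le_of_le_one_right hT0 hx.2.le, mul_nonneg hT0 hx.1.le⟩
  have h := hasSum_poised_integral hp hq ht (d := vwpCoeff (p + q + t - 1)) (w := -T)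
    (g := fun w => (1 + w) * (1 - w) ^ (-(p + q + t - 1 + 1)))
    ((hasSum_vwpCoeff (p + q + t - 1) (w := |-T|) (by rwa [abs_abs])).summable.congr fun k => by
      rw [abs_mul, abs_pow, abs_of_pos (vwpCoeff_pos (by linarith) k)])
    (fun x hx => hasSum_vwpCoeff _ (by
      have := hle x hx
      rw [neg_mul, abs_neg, abs_of_nonneg this.2]; linarith [this.1]))
  have e : poisedSum p q t (-T) = _ := (hasSum_poisedSum hp hq ht hT).unique h
  rw [e, abs_mul, abs_inv, abs_of_pos (mul_pos (ProbabilityTheory.beta_pos hp ht)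
    (ProbabilityTheory.beta_pos hq ht)), inv_mul_le_iff₀ (mul_pos (ProbabilityTheory.beta_pos hp ht)
    (ProbabilityTheory.beta_pos hq ht)), mul_one, ← integral_betaWeight hp ht hq ht,
    ← Real.norm_eq_abs]
  refine norm_integral_le_of_norm_le (integrableOn_betaWeight hp ht hq ht)
    ((ae_restrict_mem measurableSet_unitSquare).mono fun x hx => ?_)
  rw [norm_mul, Real.norm_of_nonneg (betaWeight_pos hx).le]
  refine mul_le_of_le_one_right (betaWeight_pos hx).le ?_
  have hle' := hle _ (mul_mem_Ioo_of_mem_unitSquare hx)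
  set y := T * (x.1 * x.2)
  rw [neg_mul, sub_neg_eq_add, ← sub_eq_add_neg, sub_add_cancel, norm_mul,
    Real.norm_of_nonneg (by linarith), Real.norm_of_nonneg (Real.rpow_nonneg (by linarith) _)]
  exact mul_le_one₀ (by linarith) (Real.rpow_nonneg (by linarith) _)
    (Real.rpow_le_one_of_one_le_of_nonpos (by linarith) (by linarith))

lemma continuousOn_poisedSum {p q t : ℝ} (hp : 0 < p) (hq : 0 < q) (ht : 0 < t) :
    ContinuousOn (poisedSum p q t) (Metric.ball 0 1) :=
  (analyticOnNhd_poisedSum hp hq ht).continuousOn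

lemma neg_mul_mem_ball {r : ℝ} (hr0 : 0 ≤ r) (hr1 : r ≤ 1) {p : ℝ × ℝ} (hp : p ∈ unitSquare) :
    -r * (p.1 * p.2) ∈ Metric.ball (0 : ℝ) 1 := by
  have h := mul_mem_Ioo_of_mem_unitSquare hp
  rw [mem_ball_zero_iff, Real.norm_eq_abs, neg_mul, abs_neg, abs_of_nonneg (mul_nonneg hr0 h.1.le)]
  nlinarith [h.1, h.2]

lemma aestronglyMeasurable_betaWeight_mul_poisedSum {p q t : ℝ} (hp : 0 < p) (hq : 0 < q)
    (ht : 0 < t) (α u β v : ℝ) {r : ℝ} (hr0 : 0 ≤ r) (hr1 : r ≤ 1) :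
    AEStronglyMeasurable (fun x => betaWeight α u β v x * poisedSum p q t (-r * (x.1 * x.2)))
      (volume.restrict unitSquare) := by
  refine (by fun_prop : AEStronglyMeasurable (betaWeight α u β v) _).mul ?_
  refine ContinuousOn.aestronglyMeasurable ?_ measurableSet_unitSquare
  exact (continuousOn_poisedSum hp hq ht).comp (by fun_prop) fun x hx => neg_mul_mem_ball hr0 hr1 hx

lemma norm_betaWeight_mul_poisedSum_le {p q t : ℝ} (hp : 0 < p) (hq : 0 < q)
    (ht : 0 < t) (α u β v : ℝ) {r : ℝ} (hr0 : 0 ≤ r) (hr1 : r ≤ 1) {x : ℝ × ℝ}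
    (hx : x ∈ unitSquare) :
    ‖betaWeight α u β v x * poisedSum p q t (-r * (x.1 * x.2))‖ ≤ betaWeight α u β v x := by
  have h := mul_mem_Ioo_of_mem_unitSquare hx
  rw [norm_mul, Real.norm_of_nonneg (betaWeight_pos hx).le, neg_mul]
  exact mul_le_of_le_one_right (betaWeight_pos hx).le
    (abs_poisedSum_neg_le hp hq ht (mul_nonneg hr0 h.1.le) (by nlinarith [h.1, h.2]))

/-- The quadratic transformation is integrated term by term; its terms are nonnegative on the
square, so the series dominates itself. The balance `p + q + t = α + β + s` gives `1 + xy` the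
exponent that the Dirichlet integral needs for every `n`. -/
lemma integral_betaWeight_mul_poisedSum {p q t α β s : ℝ} (hp : 0 < p) (hq : 0 < q) (ht : 0 < t)
    (hα : 0 < α) (hβ : 0 < β) (hs : 0 < s) (h : p + q + t = α + β + s) :
    HasSum (fun n : ℕ => quadCoeff p q t n * (beta (α + n) (β + n + s) * beta (β + n) s))
      (∫ x in unitSquare, betaWeight α s β s x * poisedSum p q t (-1 * (x.1 * x.2))) := by
  have hT : ∀ x ∈ unitSquare, HasSum (fun n : ℕ => betaWeight α s β s x * (quadCoeff p q t n *
      ((x.1 * x.2) ^ n * ((1 - x.1 * x.2) *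
        (1 + x.1 * x.2) ^ (-(2 * (n : ℝ) + (p + q + t))))))) (betaWeight α s β s x *
          poisedSum p q t (-1 * (x.1 * x.2))) := fun x hx => by
    rw [neg_one_mul]
    exact (hasSum_quadCoeff hp hq ht (mul_mem_Ioo_of_mem_unitSquare hx)).mul_left _
  refine (hasSum_integral_of_dominated_convergence (fun n x => betaWeight α s β s x *
    (quadCoeff p q t n * ((x.1 * x.2) ^ n * ((1 - x.1 * x.2) *
        (1 + x.1 * x.2) ^ (-(2 * (n : ℝ) + (p + q + t))))))) (fun n => by fun_prop) ?_
    ((ae_restrict_mem measurableSet_unitSquare).mono fun x hx => (hT x hx).summable) ?_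
    ((ae_restrict_mem measurableSet_unitSquare).mono hT)).congr_fun fun n => ?_
  · refine fun n => (ae_restrict_mem measurableSet_unitSquare).mono fun x hx => le_of_eq ?_
    have hm := mul_mem_Ioo_of_mem_unitSquare hx
    refine Real.norm_of_nonneg (mul_nonneg (betaWeight_pos hx).le (mul_nonneg
      (quadCoeff_pos hp hq ht n).le (mul_nonneg (pow_nonneg hm.1.le n) (mul_nonneg
        (sub_nonneg.2 hm.2.le) (Real.rpow_nonneg (by linarith [hm.1]) _)))))
  · have hi : Integrable (fun x => betaWeight α s β s x * poisedSum p q t (-1 * (x.1 * x.2)))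
        (volume.restrict unitSquare) :=
      (integrableOn_betaWeight hα hs hβ hs).mono'
        (aestronglyMeasurable_betaWeight_mul_poisedSum hp hq ht α s β s zero_le_one le_rfl)
        ((ae_restrict_mem measurableSet_unitSquare).mono fun x hx =>
          norm_betaWeight_mul_poisedSum_le hp hq ht α s β s zero_le_one le_rfl hx)
    exact hi.congr ((ae_restrict_mem measurableSet_unitSquare).mono fun x hx =>
      (hT x hx).tsum_eq.symm)
  · rw [← integral_betaWeight_mul_rpow (by positivity) (by positivity) hs, ← integral_const_mul]
    refine setIntegral_congr_fun measurableSet_unitSquare fun x hx => ?_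
    rw [← betaWeight_mul_pow hx, show α + n + (β + n) + s = 2 * n + (p + q + t) by rw [h]; ring]
    ring

lemma HasAbelSum.const_mul {f : ℕ → ℝ} {s : ℝ} (h : HasAbelSum f s) (c : ℝ) :
    HasAbelSum (fun n => c * f n) (c * s) := by
  refine ⟨fun r hr => ((h.1 r hr).mul_left c).congr fun n => (mul_assoc _ _ _).symm, ?_⟩
  refine (h.2.const_mul c).congr fun r => ?_
  rw [← tsum_mul_left]
  exact tsum_congr fun n => (mul_assoc _ _ _).symm

/-- The Abel sum of the very-well-poised series at `-1`. -/
lemma hasAbelSum_poised {p q t α β s : ℝ} (hp : 0 < p) (hq : 0 < q) (ht : 0 < t)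
    (hα : 0 < α) (hβ : 0 < β) (hs : 0 < s) :
    HasAbelSum (fun n => poisedCoeff p q t n *
        (rising α n * rising β n / (rising (α + s) n * rising (β + s) n)) * (-1) ^ n)
      ((beta α s * beta β s)⁻¹ *
        ∫ x in unitSquare, betaWeight α s β s x * poisedSum p q t (-1 * (x.1 * x.2))) := by
  have key : ∀ r ∈ Ico (0 : ℝ) 1, HasSum (fun n => poisedCoeff p q t n *
        (rising α n * rising β n / (rising (α + s) n * rising (β + s) n)) * (-1) ^ n * r ^ n)
      ((beta α s * beta β s)⁻¹ *
        ∫ x in unitSquare, betaWeight α s β s x * poisedSum p q t (-r * (x.1 * x.2))) :=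
    fun r hr => by
      have hr' : |-r| < 1 := by rw [abs_neg, abs_of_nonneg hr.1]; exact hr.2
      refine (hasSum_poised_integral hα hβ hs (d := poisedCoeff p q t) (g := poisedSum p q t)
        (summable_poisedCoeff hp hq ht hr') fun x hx => hasSum_poisedSum hp hq ht ?_).congr_fun
        fun n => ?_
      · rw [neg_mul, abs_neg, abs_of_nonneg (mul_nonneg hr.1 hx.1.le)]
        nlinarith [hr.1, hr.2, hx.1, hx.2]
      · rw [neg_pow r]; ring
  refine ⟨fun r hr => (key r hr).summable, ?_⟩
  have hev : ∀ᶠ r : ℝ in 𝓝[<] 1, r ∈ Ico (0 : ℝ) 1 :=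
    Ico_mem_nhdsLT zero_lt_one
  have hlim : Tendsto (fun r : ℝ => ∫ x in unitSquare,
      betaWeight α s β s x * poisedSum p q t (-r * (x.1 * x.2))) (𝓝[<] 1)
      (𝓝 (∫ x in unitSquare, betaWeight α s β s x * poisedSum p q t (-1 * (x.1 * x.2)))) := by
    -- Since `poisedSum` is bounded by 1 on `(-1, 0]`, the beta weight itself is the majorant.
    refine tendsto_integral_filter_of_dominated_convergence (betaWeight α s β s)
      (hev.mono fun r hr =>
        aestronglyMeasurable_betaWeight_mul_poisedSum hp hq ht α s β s hr.1 hr.2.le)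
      (hev.mono fun r hr => (ae_restrict_mem measurableSet_unitSquare).mono fun x hx =>
        norm_betaWeight_mul_poisedSum_le hp hq ht α s β s hr.1 hr.2.le hx)
      (integrableOn_betaWeight hα hs hβ hs)
      ((ae_restrict_mem measurableSet_unitSquare).mono fun x hx => ?_)
    have hc : ContinuousAt (poisedSum p q t) (-1 * (x.1 * x.2)) :=
      (continuousOn_poisedSum hp hq ht).continuousAt
        (Metric.isOpen_ball.mem_nhds (neg_mul_mem_ball zero_le_one le_rfl hx))
    have hl : Tendsto (fun r : ℝ => -r * (x.1 * x.2)) (𝓝[<] 1) (𝓝 (-1 * (x.1 * x.2))) :=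
      ((continuous_neg.mul continuous_const).tendsto 1).mono_left nhdsWithin_le_nhds
    exact (hc.tendsto.comp hl).const_mul _
  exact (hlim.const_mul _).congr' (hev.mono fun r hr => (key r hr).tsum_eq.symm)

/-- The preceding lemmas apply with `p, q, t = h₁, h₂, a₁` and `α, β = h₃, h₄`; the required balance
holds because both sums equal `1 + h₀`. -/
lemma hasAbelSum_term₆F₅ {h₀ h₁ h₂ h₃ h₄ a₁ b₂ b₃ : ℝ} (ha₁ : a₁ = 1 + h₀ - h₁ - h₂)
    (hb₂ : b₂ = 1 + h₀ - h₁) (hb₃ : b₃ = 1 + h₀ - h₂)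
    (hc : ∀ i, -1 < paramSet a₁ h₃ h₄ b₂ b₃ i) (h0 : h₀ ≠ 0) :
    HasAbelSum (term₆F₅ h₀ h₁ h₂ h₃ h₄) (H (paramSet a₁ h₃ h₄ b₂ b₃)) := by
  obtain ⟨⟨p1, p2, p3⟩, ⟨p4, p5, p6⟩, ⟨p7, p8, p9⟩, p10⟩ := paramSet_pos hc
  set s := b₂ + b₃ - a₁ - h₃ - h₄ with hs
  have hh₁ : h₁ = b₃ - a₁ := by linarith
  have hh₂ : h₂ = b₂ - a₁ := by linarith
  have hh₀ : h₀ = b₂ + b₃ - a₁ - 1 := by linarith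
  have q1 : 0 < h₁ := by linarith
  have q2 : 0 < h₂ := by linarith
  have hsum : h₁ + h₂ + a₁ = h₃ + h₄ + s := by linarith
  have hA := (hasAbelSum_poised q1 q2 p1 p2 p3 p10).const_mul
    (Real.Gamma (1 + h₀) * Real.Gamma h₃ * Real.Gamma h₄ * Real.Gamma (1 + h₀ - h₁ - h₃) *
        Real.Gamma (1 + h₀ - h₂ - h₄) * Real.Gamma (1 + h₀ - h₃ - h₄) /
      (Real.Gamma (1 + h₀ - h₁) * Real.Gamma (1 + h₀ - h₂) *
        Real.Gamma (1 + h₀ - h₃) * Real.Gamma (1 + h₀ - h₄)))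
  have e3 : 1 + h₀ - h₃ = h₄ + s := by linarith
  have e4 : 1 + h₀ - h₄ = h₃ + s := by linarith
  have e1 : 1 + h₀ - h₁ = h₂ + a₁ := by linarith
  have e2 : 1 + h₀ - h₂ = h₁ + a₁ := by linarith
  have e34 : 1 + h₀ - h₃ - h₄ = s := by linarith
  have e0 : 1 + h₀ = h₃ + h₄ + s := by linarith
  convert hA using 1
  · funext n
    have hh : h₁ + h₂ + a₁ - 1 = h₀ := by linarith
    rw [poisedCoeff, hh, vwpCoeff_eq h0]
    simp only [term₆F₅, hgCoeff, List.map_cons, List.map_nil, List.prod_cons, List.prod_nil,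
      ← rising.eq_1, mul_one]
    congr 2
    have hr : rising (1 + h₀ / 2) n * (h₀ / 2) = rising (h₀ / 2) n * (h₀ / 2 + n) := by
      rw [← rising_succ, rising_succ', add_comm (h₀ / 2) 1, mul_comm]
    have hpos : 0 < 1 + h₀ / 2 := by linarith
    -- Here `h₀` may be negative, but `h₀ > -1`, so positivity of `1 + h₀ / 2` gives the
    -- nonvanishing.
    have hr0 : rising (h₀ / 2) n ≠ 0 := by
      intro h
      rw [h, zero_mul] at hr
      exact (mul_pos (rising_pos hpos n) one_pos).ne' (by
        rw [mul_one]; exact (mul_eq_zero.1 hr).resolve_right (by simpa using h0))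
    have hr' : rising (1 + h₀ / 2) n = rising (h₀ / 2) n * (h₀ + 2 * n) / h₀ := by
      rw [eq_div_iff h0]; linear_combination 2 * hr
    rw [hr', e1, e2, e3, e4]
    have := rising_pos (show 0 < h₂ + a₁ by linarith) n
    have := rising_pos (show 0 < h₁ + a₁ by linarith) n
    have := rising_pos (show 0 < h₃ + s by linarith) n
    have := rising_pos (show 0 < h₄ + s by linarith) n
    field_simp
  · refine (hasSum_term₃F₂ hc).unique ?_
    refine (((integral_betaWeight_mul_poisedSum q1 q2 p1 p2 p3 p10 hsum).mul_left _).mul_left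
      _).congr_fun fun n => ?_
    rw [quadCoeff, hsum]
    simp only [beta, term₃F₂, hgCoeff, List.map_cons, List.map_nil, List.prod_cons, List.prod_nil,
      ← rising.eq_1, mul_one, one_pow]
    rw [show h₃ + n + (h₄ + n + s) = h₃ + h₄ + s + (2 * n : ℕ) by push_cast; ring,
      Gamma_add_natCast (show 0 < h₃ + h₄ + s by linarith), Gamma_add_natCast p2,
      Gamma_add_natCast p3, e34, e3, e4, e0, show h₃ + h₄ + s - h₁ = b₂ by linarith,
      show h₃ + h₄ + s - h₂ = b₃ by linarith, show h₁ + a₁ = b₃ by linarith,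
      show h₂ + a₁ = b₂ by linarith]
    have := rising_pos (show 0 < b₂ by linarith) n
    have := rising_pos (show 0 < b₃ by linarith) n
    have := rising_pos (show 0 < h₃ + h₄ + s by linarith) (2 * n)
    have := Real.Gamma_pos_of_pos (show 0 < b₂ by linarith)
    have := Real.Gamma_pos_of_pos (show 0 < b₃ by linarith)
    have := Real.Gamma_pos_of_pos (show 0 < h₃ + h₄ + s by linarith)
    have := Real.Gamma_pos_of_pos (show 0 < h₃ + s by linarith)
    have := Real.Gamma_pos_of_pos (show 0 < h₄ + s by linarith)
    have := Real.Gamma_pos_of_pos (show 0 < h₄ + n + s by positivity)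
    have := Real.Gamma_pos_of_pos p2
    have := Real.Gamma_pos_of_pos p3
    have := Real.Gamma_pos_of_pos p10
    field_simp

/-! ### Abel sums -/

lemma HasAbelSum.unique {f : ℕ → ℝ} {s t : ℝ} (hs : HasAbelSum f s) (ht : HasAbelSum f t) : s = t :=
  tendsto_nhds_unique hs.2 ht.2

lemma HasAbelSum.add {f g : ℕ → ℝ} {s t : ℝ} (hf : HasAbelSum f s) (hg : HasAbelSum g t) :
    HasAbelSum (fun n => f n + g n) (s + t) := by
  refine ⟨fun r hr => ((hf.1 r hr).add (hg.1 r hr)).congr fun n => (add_mul _ _ _).symm, ?_⟩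
  refine (hf.2.add hg.2).congr' ?_
  filter_upwards [Ico_mem_nhdsLT (zero_lt_one : (0 : ℝ) < 1)] with r hr
  rw [← (hf.1 r hr).tsum_add (hg.1 r hr)]
  exact tsum_congr fun n => (add_mul _ _ _).symm

lemma HasAbelSum.shift {f : ℕ → ℝ} {s : ℝ} (h : HasAbelSum f s) :
    HasAbelSum (fun n => f (n + 1)) (s - f 0) := by
  have key : ∀ r ∈ Ioo (0 : ℝ) 1,
      HasSum (fun n => f (n + 1) * r ^ n) (r⁻¹ * ((∑' n, f n * r ^ n) - f 0)) := fun r hr => by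
    have h1 := (hasSum_nat_add_iff' 1).2 (h.1 r ⟨hr.1.le, hr.2⟩).hasSum
    simp only [Finset.sum_range_one, pow_zero, mul_one] at h1
    refine (h1.mul_left r⁻¹).congr_fun fun n => ?_
    have := hr.1.ne'
    rw [pow_succ]
    field_simp
  refine ⟨fun r hr => ?_, ?_⟩
  · rcases hr.1.eq_or_lt with rfl | h0
    · refine summable_of_ne_finset_zero (s := {0}) fun n hn => ?_
      rw [zero_pow (by simpa using hn), mul_zero]
    · exact (key r ⟨h0, hr.2⟩).summable
  · have h1 : Tendsto (fun r : ℝ => r⁻¹) (𝓝[<] 1) (𝓝 1⁻¹) :=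
      (tendsto_inv₀ one_ne_zero).mono_left nhdsWithin_le_nhds
    have h2 := h1.mul (h.2.sub_const (f 0))
    rw [inv_one, one_mul] at h2
    refine h2.congr' ?_
    filter_upwards [Ioo_mem_nhdsLT (zero_lt_one : (0 : ℝ) < 1)] with r hr
    exact (key r hr).tsum_eq.symm

lemma hasAbelSum_choose (k : ℕ) :
    HasAbelSum (fun n => (-1) ^ n * ((n + k).choose k : ℝ)) ((1 / 2) ^ (k + 1)) := by
  have key : ∀ r ∈ Ico (0 : ℝ) 1, HasSum (fun n : ℕ => (-1) ^ n * ((n + k).choose k : ℝ) * r ^ n)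
      (1 / (1 + r) ^ (k + 1)) := fun r hr => by
    have h := hasSum_choose_mul_geometric_of_norm_lt_one k (r := -r) (by
      rw [norm_neg, Real.norm_of_nonneg hr.1]; exact hr.2)
    rw [sub_neg_eq_add] at h
    refine h.congr_fun fun n => ?_
    rw [neg_pow r]; ring
  refine ⟨fun r hr => (key r hr).summable, ?_⟩
  have hc : ContinuousAt (fun r : ℝ => 1 / (1 + r) ^ (k + 1)) 1 := by
    refine ContinuousAt.div continuousAt_const (by fun_prop) (by positivity)
  have h1 := hc.tendsto.mono_left (nhdsWithin_le_nhds (s := Iio 1))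
  rw [show (1 : ℝ) / (1 + 1) ^ (k + 1) = (1 / 2) ^ (k + 1) by
    rw [one_div_pow]; norm_num] at h1
  refine h1.congr' ?_
  filter_upwards [Ico_mem_nhdsLT (zero_lt_one : (0 : ℝ) < 1)] with r hr
  exact (key r hr).tsum_eq.symm

/-- Write `n + c = (n + k + 1) + (c - k - 1)`; the first summand raises `k` by one in the binomial
coefficient. The extra parameter `k` is what makes the induction on `i` close. -/
lemma exists_hasAbelSum_pow_mul_choose (c : ℚ) (i k : ℕ) :
    ∃ q : ℚ, HasAbelSum (fun n => (-1) ^ n * (((n : ℝ) + c) ^ i * ((n + k).choose k : ℝ))) q := by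
  induction i generalizing k with
  | zero => exact ⟨(1 / 2) ^ (k + 1), by simpa using hasAbelSum_choose k⟩
  | succ i ih =>
    obtain ⟨q₁, h₁⟩ := ih (k + 1)
    obtain ⟨q₂, h₂⟩ := ih k
    refine ⟨(k + 1) * q₁ + (c - k - 1) * q₂, ?_⟩
    have h := (h₁.const_mul (k + 1)).add (h₂.const_mul (c - k - 1))
    push_cast
    convert! h using 1
    funext n
    have hch : ((n : ℝ) + k + 1) * ((n + k).choose k : ℝ) =
        ((n + (k + 1)).choose (k + 1) : ℝ) * (k + 1) := by
      have := Nat.add_one_mul_choose_eq (n + k) k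
      rw [← add_assoc n k 1]
      exact_mod_cast this
    linear_combination (-1) ^ n * ((n : ℝ) + c) ^ i * hch

lemma exists_hasAbelSum_pow (c : ℚ) (i : ℕ) :
    ∃ q : ℚ, HasAbelSum (fun n => (-1) ^ n * ((n : ℝ) + c) ^ i) q := by
  simpa using exists_hasAbelSum_pow_mul_choose c i 0

lemma tendsto_inv_add_half_pow {j : ℕ} (hj : 1 ≤ j) :
    Tendsto (fun n : ℕ => (((n : ℝ) + 1 / 2) ^ j)⁻¹) atTop (𝓝 0) :=
  tendsto_inv_atTop_zero.comp ((tendsto_pow_atTop (by omega)).comp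
    (tendsto_atTop_add_const_right _ _ tendsto_natCast_atTop_atTop))

lemma antitone_inv_add_half_pow (j : ℕ) : Antitone fun n : ℕ => (((n : ℝ) + 1 / 2) ^ j)⁻¹ := by
  intro m n hmn
  have : (m : ℝ) ≤ n := by exact_mod_cast hmn
  simp only
  gcongr

lemma hasAbelSum_inv_add_half_pow {j : ℕ} {b : ℝ}
    (h : Tendsto (fun n => ∑ i ∈ Finset.range n, (-1) ^ i * (((i : ℝ) + 1 / 2) ^ j)⁻¹) atTop (𝓝 b)) :
    HasAbelSum (fun n => (-1) ^ n * (((n : ℝ) + 1 / 2) ^ j)⁻¹) b := by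
  refine ⟨fun r hr => ?_, Real.tendsto_tsum_powerSeries_nhdsWithin_lt h⟩
  refine Summable.of_norm_bounded ((summable_geometric_of_lt_one hr.1 hr.2).mul_left
    (((0 : ℝ) + 1 / 2) ^ j)⁻¹) fun n => ?_
  rw [norm_mul, norm_mul, norm_pow, norm_neg, norm_one, one_pow, one_mul,
    Real.norm_of_nonneg (by positivity), Real.norm_of_nonneg (pow_nonneg hr.1 n)]
  have := antitone_inv_add_half_pow j (Nat.zero_le n)
  simp only [Nat.cast_zero] at this
  exact mul_le_mul_of_nonneg_right this (pow_nonneg hr.1 n)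

lemma exists_hasAbelSum_inv_add_half_pow {j : ℕ} (hj : 1 ≤ j) :
    ∃ b, HasAbelSum (fun n => (-1) ^ n * (((n : ℝ) + 1 / 2) ^ j)⁻¹) b := by
  obtain ⟨b, hb⟩ := (antitone_inv_add_half_pow j).tendsto_alternating_series_of_tendsto_zero
    (tendsto_inv_add_half_pow hj)
  exact ⟨b, hasAbelSum_inv_add_half_pow hb⟩

lemma hasAbelSum_inv_add_half_sq :
    HasAbelSum (fun n => (-1) ^ n * (((n : ℝ) + 1 / 2) ^ 2)⁻¹) (4 * catalanG) := by
  have hs : Summable fun n : ℕ => (-1 : ℝ) ^ n / (2 * (n : ℝ) + 1) ^ 2 := by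
    have h1 : Summable fun n : ℕ => 1 / ((n + 1 : ℕ) : ℝ) ^ 2 :=
      (summable_nat_add_iff 1).2 (Real.summable_one_div_nat_pow.2 one_lt_two)
    refine Summable.of_norm_bounded h1 fun n => ?_
    rw [norm_div, norm_pow, norm_neg, norm_one, one_pow, Real.norm_of_nonneg (by positivity)]
    have : (0 : ℝ) ≤ n := n.cast_nonneg
    gcongr
    push_cast
    linarith
  refine hasAbelSum_inv_add_half_pow ?_
  have h := (hs.hasSum.mul_left 4).tendsto_sum_nat
  refine h.congr fun n => Finset.sum_congr rfl fun i _ => ?_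
  have : (0 : ℝ) ≤ i := i.cast_nonneg
  have e : (2 * (i : ℝ) + 1) ^ 2 = 4 * ((i : ℝ) + 1 / 2) ^ 2 := by ring
  rw [e]
  field_simp

/-- Each shift by one removes a rational first term and reverses the sign. -/
lemma exists_hasAbelSum_inv_add_pow {j : ℕ} {b : ℝ}
    (hb : HasAbelSum (fun n => (-1) ^ n * (((n : ℝ) + 1 / 2) ^ j)⁻¹) b) (m : ℕ) :
    ∃ q : ℚ, HasAbelSum (fun n => (-1) ^ n * (((n : ℝ) + m + 1 / 2) ^ j)⁻¹) (q + (-1) ^ m * b) := by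
  induction m with
  | zero => exact ⟨0, by simpa using hb⟩
  | succ m ih =>
    obtain ⟨q, hq⟩ := ih
    refine ⟨-(q - (((m : ℚ) + 1 / 2) ^ j)⁻¹), ?_⟩
    have h := hq.shift.const_mul (-1)
    convert! h using 1
    · funext n
      rw [pow_succ]
      push_cast
      rw [show (n : ℝ) + (m + 1) = n + 1 + m by ring]
      ring
    · push_cast
      rw [pow_zero, one_mul, zero_add, pow_succ]
      ring

/-! ### Rational functions with poles at half-integers -/

/-- The functions on `ℤ` that are `ℚ`-linear combinations of powers of `z` and of
`(z + m + 1/2)⁻ʲ` with `1 ≤ j ≤ ord m`. -/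
noncomputable def partialFractions (ord : ℕ → ℕ) : Submodule ℚ (ℤ → ℝ) :=
  Submodule.span ℚ ({f | ∃ i : ℕ, f = fun z : ℤ => (z : ℝ) ^ i} ∪
    {f | ∃ m j : ℕ, 1 ≤ j ∧ j ≤ ord m ∧ f = fun z : ℤ => (((z : ℝ) + m + 1 / 2) ^ j)⁻¹})

lemma pow_mem_partialFractions (ord : ℕ → ℕ) (i : ℕ) :
    (fun z : ℤ => (z : ℝ) ^ i) ∈ partialFractions ord :=
  Submodule.subset_span (Or.inl ⟨i, rfl⟩)

lemma inv_pow_mem_partialFractions {ord : ℕ → ℕ} {m j : ℕ} (hj : j ≤ ord m) :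
    (fun z : ℤ => (((z : ℝ) + m + 1 / 2) ^ j)⁻¹) ∈ partialFractions ord := by
  rcases Nat.eq_zero_or_pos j with rfl | h
  · simpa using pow_mem_partialFractions ord 0
  · exact Submodule.subset_span (Or.inr ⟨m, j, h, hj, rfl⟩)

lemma partialFractions_mono {ord ord' : ℕ → ℕ} (h : ord ≤ ord') :
    partialFractions ord ≤ partialFractions ord' :=
  Submodule.span_mono (union_subset_union_right _
    fun _ ⟨m, j, h1, h2, h3⟩ => ⟨m, j, h1, h2.trans (h m), h3⟩)

lemma intCast_add_half_ne_zero (z : ℤ) (m : ℕ) : (z : ℝ) + m + 1 / 2 ≠ 0 := by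
  intro h
  have h' : ((2 * z + 2 * m + 1 : ℤ) : ℝ) = 0 := by push_cast; linear_combination 2 * h
  have : 2 * z + 2 * m + 1 = 0 := by exact_mod_cast h'
  omega

lemma ratCast_mul_mem_partialFractions {ord : ℕ → ℕ} {f : ℤ → ℝ} (hf : f ∈ partialFractions ord)
    (c : ℚ) : (fun z => (c : ℝ) * f z) ∈ partialFractions ord := by
  have := (partialFractions ord).smul_mem c hf
  convert! this using 1

/-- Multiplication by `g` is linear, so it suffices to treat the spanning functions. -/
lemma partialFractions_induction {ord ord' : ℕ → ℕ} {g : ℤ → ℝ}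
    (h1 : ∀ i : ℕ, (fun z : ℤ => g z * (z : ℝ) ^ i) ∈ partialFractions ord')
    (h2 : ∀ m j : ℕ, 1 ≤ j → j ≤ ord m →
      (fun z : ℤ => g z * (((z : ℝ) + m + 1 / 2) ^ j)⁻¹) ∈ partialFractions ord')
    {f : ℤ → ℝ} (hf : f ∈ partialFractions ord) :
    (fun z => g z * f z) ∈ partialFractions ord' := by
  induction hf using Submodule.span_induction with
  | mem f hf =>
    rcases hf with ⟨i, rfl⟩ | ⟨m, j, hj, hj', rfl⟩
    · exact h1 i
    · exact h2 m j hj hj'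
  | zero =>
    convert! (partialFractions ord').zero_mem using 1
    funext z; simp
  | add f g _ _ hf hg =>
    convert! (partialFractions ord').add_mem hf hg using 1
    funext z; simp [mul_add]
  | smul c f _ hf =>
    convert! (partialFractions ord').smul_mem c hf using 1
    funext z; simp [Rat.smul_def]; ring

/-- At a pole, `z + c = (z + m + 1/2) + (c - m - 1/2)`: a linear factor never raises pole orders. -/
lemma add_mul_mem_partialFractions {ord : ℕ → ℕ} {f : ℤ → ℝ} (hf : f ∈ partialFractions ord)
    (c : ℚ) : (fun z : ℤ => ((z : ℝ) + c) * f z) ∈ partialFractions ord := by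
  refine partialFractions_induction (g := fun z : ℤ => (z : ℝ) + c) (fun i => ?_) (fun m j hj hj' => ?_) hf
  · convert! (partialFractions ord).add_mem (pow_mem_partialFractions ord (i + 1))
      (ratCast_mul_mem_partialFractions (pow_mem_partialFractions ord i) c) using 1
    funext z; simp; ring
  · obtain ⟨j, rfl⟩ : ∃ k, j = k + 1 := ⟨j - 1, by omega⟩
    convert! (partialFractions ord).add_mem (inv_pow_mem_partialFractions (m := m) (j := j)
      (by omega)) (ratCast_mul_mem_partialFractions (inv_pow_mem_partialFractions hj')
        (c - (m + 1 / 2))) using 1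
    funext z
    have := mul_inv_cancel₀ (intCast_add_half_ne_zero z m)
    simp only [Pi.add_apply]
    push_cast
    rw [pow_succ, mul_inv]
    linear_combination (((z : ℝ) + m + 1 / 2) ^ j)⁻¹ * this

/-- At `l = m` the exponent grows by one. At `l ≠ m` the product of two distinct simple fractions
splits into their difference, which reduces `j` step by step. -/
lemma inv_mul_mem_partialFractions {ord : ℕ → ℕ} {f : ℤ → ℝ} (hf : f ∈ partialFractions ord)
    (m : ℕ) : (fun z : ℤ => ((z : ℝ) + m + 1 / 2)⁻¹ * f z) ∈
      partialFractions (fun k => ord k + if k = m then 1 else 0) := by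
  have h0 : (fun z : ℤ => ((z : ℝ) + m + 1 / 2)⁻¹) ∈
      partialFractions (fun k => ord k + if k = m then 1 else 0) := by
    simpa using inv_pow_mem_partialFractions (m := m) (j := 1)
      (ord := fun k => ord k + if k = m then 1 else 0) (by simp)
  refine partialFractions_induction (g := fun z : ℤ => ((z : ℝ) + m + 1 / 2)⁻¹) (fun i => ?_)
    (fun l j hj hj' => ?_) hf
  · induction i with
    | zero => simpa using h0
    | succ i ih =>
      convert! add_mul_mem_partialFractions ih 0 using 1
      funext z
      simp only [Rat.cast_zero]
      ring
  · rcases eq_or_ne l m with rfl | hlm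
    · convert! inv_pow_mem_partialFractions (m := l) (j := j + 1)
        (ord := fun k => ord k + if k = l then 1 else 0) (by simpa using hj') using 1
      funext z
      rw [pow_succ, mul_inv, mul_comm]
    · clear hj
      induction j with
      | zero => simpa using h0
      | succ j ih =>
        have h1 := ratCast_mul_mem_partialFractions (ih (by omega)) ((l : ℚ) - m)⁻¹
        have h2 := ratCast_mul_mem_partialFractions (inv_pow_mem_partialFractions (m := l)
          (j := j + 1) (ord := fun k => ord k + if k = m then 1 else 0) (by omega))
          (-((l : ℚ) - m)⁻¹)
        convert! (partialFractions _).add_mem h1 h2 using 1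
        funext z
        have e1 := intCast_add_half_ne_zero z m
        have e2 := intCast_add_half_ne_zero z l
        have e3 : (l : ℝ) - m ≠ 0 := sub_ne_zero.2 (by exact_mod_cast hlm)
        simp only [Pi.add_apply]
        push_cast
        rw [pow_succ, mul_inv]
        have key : ((z : ℝ) + m + 1 / 2)⁻¹ * ((z : ℝ) + l + 1 / 2)⁻¹ =
            ((l : ℝ) - m)⁻¹ * (((z : ℝ) + m + 1 / 2)⁻¹ - ((z : ℝ) + l + 1 / 2)⁻¹) := by
          rw [inv_sub_inv e1 e2, show (z : ℝ) + l + 1 / 2 - (z + m + 1 / 2) = l - m by ring,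
            ← mul_inv, inv_mul_eq_div, div_div_cancel_left' e3]
        linear_combination (((z : ℝ) + l + 1 / 2) ^ j)⁻¹ * key

lemma rising_mul_mem_partialFractions {ord : ℕ → ℕ} {f : ℤ → ℝ} (hf : f ∈ partialFractions ord)
    (c : ℚ) (k : ℕ) : (fun z : ℤ => rising ((z : ℝ) + c) k * f z) ∈ partialFractions ord := by
  induction k with
  | zero => simpa using hf
  | succ k ih =>
    convert! add_mul_mem_partialFractions ih (c + k) using 1
    funext z
    rw [rising_succ]; push_cast; ring

lemma inv_rising_mul_mem_partialFractions {ord : ℕ → ℕ} {f : ℤ → ℝ}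
    (hf : f ∈ partialFractions ord) (l k : ℕ) :
    (fun z : ℤ => (rising ((z : ℝ) + l + 1 / 2) k)⁻¹ * f z) ∈
      partialFractions (fun i => ord i + if i ∈ Finset.Ico l (l + k) then 1 else 0) := by
  induction k with
  | zero => simpa using hf
  | succ k ih =>
    have h := inv_mul_mem_partialFractions ih (l + k)
    have e : (fun i => ord i + (if i ∈ Finset.Ico l (l + k) then 1 else 0) +
        if i = l + k then 1 else 0) =
        fun i => ord i + if i ∈ Finset.Ico l (l + (k + 1)) then 1 else 0 := by
      funext i
      simp only [Finset.mem_Ico]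
      split_ifs <;> omega
    rw [e] at h
    convert! h using 1
    funext z
    rw [rising_succ, mul_inv]
    push_cast
    rw [show (z : ℝ) + l + 1 / 2 + k = z + (l + k) + 1 / 2 by ring]
    ring

/-- Both the series `∑ (-1)ⁿ f n` and its reflection under `z ↦ -N - z` have Abel sums in the span
of `1` and the numbers `β j`, with coefficients matching up to the sign `-(-1)ʲ`. -/
def HasReflectedAbelSums (N : ℕ) (β : ℕ → ℝ) (f : ℤ → ℝ) : Prop :=
  ∃ q q' : ℚ, ∃ B : ℕ → ℚ,
    HasAbelSum (fun n => (-1) ^ n * f n) (q + ∑ j ∈ Finset.range 4, B j * β j) ∧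
    HasAbelSum (fun n => (-1) ^ n * ((-1) ^ N * f (-N - n)))
      (q' - ∑ j ∈ Finset.range 4, (-1) ^ j * B j * β j)

lemma hasReflectedAbelSums_pow (N : ℕ) (β : ℕ → ℝ) (i : ℕ) :
    HasReflectedAbelSums N β fun z => (z : ℝ) ^ i := by
  obtain ⟨q, hq⟩ := exists_hasAbelSum_pow 0 i
  obtain ⟨q', hq'⟩ := exists_hasAbelSum_pow N i
  refine ⟨q, (-1) ^ N * (-1) ^ i * q', 0, ?_, ?_⟩
  · simpa using hq
  · convert! hq'.const_mul ((-1) ^ N * (-1) ^ i) using 1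
    · funext n
      push_cast
      rw [show -(N : ℝ) - n = -(n + N) by ring, neg_pow ((n : ℝ) + N)]; ring
    · simp

/-- The reflection sends the pole with index `m` to the one with index `k = N - 1 - m` and
contributes `(-1)ʲ`. The shifts contribute `(-1)ᵐ` and `(-1)ᵏ`; with `(-1)ᴺ = (-1)^(m + 1 + k)` the
relative sign is `-(-1)ʲ`. -/
lemma hasReflectedAbelSums_inv_pow {N : ℕ} {β : ℕ → ℝ}
    (hβ : ∀ j, 1 ≤ j → HasAbelSum (fun n => (-1) ^ n * (((n : ℝ) + 1 / 2) ^ j)⁻¹) (β j))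
    {m j : ℕ} (hm : m < N) (hj : 1 ≤ j) (hj' : j ≤ 3) :
    HasReflectedAbelSums N β fun z => (((z : ℝ) + m + 1 / 2) ^ j)⁻¹ := by
  obtain ⟨k, rfl⟩ : ∃ k, N = m + 1 + k := ⟨N - (m + 1), by omega⟩
  obtain ⟨q, hq⟩ := exists_hasAbelSum_inv_add_pow (hβ j hj) m
  obtain ⟨q', hq'⟩ := exists_hasAbelSum_inv_add_pow (hβ j hj) k
  have hmem : j ∈ Finset.range 4 := Finset.mem_range.2 (by omega)
  refine ⟨q, (-1) ^ (m + 1 + k) * (-1) ^ j * q', Pi.single j ((-1) ^ m), ?_, ?_⟩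
  · convert! hq using 2
    rw [Finset.sum_eq_single_of_mem j hmem fun i _ hi => by rw [Pi.single_eq_of_ne hi]; simp,
      Pi.single_eq_same]
    push_cast; rfl
  · convert! hq'.const_mul ((-1) ^ (m + 1 + k) * (-1) ^ j) using 1
    · funext n
      push_cast
      rw [show -((m : ℝ) + 1 + k) - n + m + 1 / 2 = -(n + k + 1 / 2) by ring,
        neg_pow ((n : ℝ) + k + 1 / 2), mul_inv,
        ← inv_pow, inv_neg_one]
      ring
    · rw [Finset.sum_eq_single_of_mem j hmem fun i _ hi => by rw [Pi.single_eq_of_ne hi]; simp,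
        Pi.single_eq_same]
      push_cast
      have : (-1 : ℝ) ^ k * (-1) ^ k = 1 := by
        rw [← pow_add, ← two_mul]; exact Even.neg_one_pow (even_two_mul k)
      rw [pow_add, pow_succ]
      linear_combination (-1) ^ m * (-1) ^ j * β j * this

lemma hasReflectedAbelSums_of_mem {N : ℕ} {β : ℕ → ℝ}
    (hβ : ∀ j, 1 ≤ j → HasAbelSum (fun n => (-1) ^ n * (((n : ℝ) + 1 / 2) ^ j)⁻¹) (β j))
    {f : ℤ → ℝ} (hf : f ∈ partialFractions fun i => if i ∈ Finset.range N then 3 else 0) :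
    HasReflectedAbelSums N β f := by
  induction hf using Submodule.span_induction with
  | mem f hf =>
    rcases hf with ⟨i, rfl⟩ | ⟨m, j, hj, hj', rfl⟩
    · exact hasReflectedAbelSums_pow N β i
    · simp only [Finset.mem_range] at hj'
      split_ifs at hj' with hm
      · exact hasReflectedAbelSums_inv_pow hβ hm hj hj'
      · omega
  | zero =>
    have h0 : HasAbelSum (fun _ => 0) 0 :=
      ⟨fun r _ => by simp, by simp⟩
    exact ⟨0, 0, 0, by simpa using h0, by simpa using h0⟩
  | add f g _ _ hf hg =>
    obtain ⟨q₁, q₁', B₁, h₁, h₁'⟩ := hf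
    obtain ⟨q₂, q₂', B₂, h₂, h₂'⟩ := hg
    refine ⟨q₁ + q₂, q₁' + q₂', B₁ + B₂, ?_, ?_⟩
    · convert! h₁.add h₂ using 1
      · funext n; simp only [Pi.add_apply]; ring
      · simp only [Pi.add_apply, Finset.sum_range_succ, Finset.sum_range_zero]; push_cast; ring
    · convert! h₁'.add h₂' using 1
      · funext n; simp only [Pi.add_apply]; ring
      · simp only [Pi.add_apply, Finset.sum_range_succ, Finset.sum_range_zero]; push_cast; ring
  | smul c f _ hf =>
    obtain ⟨q, q', B, h, h'⟩ := hf
    refine ⟨c * q, c * q', c • B, ?_, ?_⟩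
    · convert! h.const_mul c using 1
      · funext n; simp only [Pi.smul_apply, Rat.smul_def]; ring
      · simp only [Pi.smul_apply, smul_eq_mul, Finset.sum_range_succ, Finset.sum_range_zero]
        push_cast; ring
    · convert! h'.const_mul c using 1
      · funext n; simp only [Pi.smul_apply, Rat.smul_def]; ring
      · simp only [Pi.smul_apply, smul_eq_mul, Finset.sum_range_succ, Finset.sum_range_zero]
        push_cast; ring

/-- The alternating series of a rational function with at most triple poles at half-integers and
the symmetry `f (-N - z) = -(-1)ᴺ f z` only involves Catalan's constant. -/
lemma exists_hasAbelSum_catalanG {N : ℕ} {f : ℤ → ℝ}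
    (hf : f ∈ partialFractions fun i => if i ∈ Finset.range N then 3 else 0)
    (hsymm : ∀ z, f (-N - z) = -(-1) ^ N * f z) :
    ∃ p q : ℚ, HasAbelSum (fun n => (-1) ^ n * f n) (p * catalanG + q) := by
  choose! β hβ using fun j (hj : 1 ≤ j) => exists_hasAbelSum_inv_add_half_pow hj
  -- The index `0` occurs in the sums over `Finset.range 4` but has no meaning here; its value is
  -- set to `0`.
  have hβ' : ∀ j, 1 ≤ j → HasAbelSum (fun n => (-1) ^ n * (((n : ℝ) + 1 / 2) ^ j)⁻¹)
      (Function.update β 0 0 j) := fun j hj => by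
    rw [Function.update_of_ne (by omega)]; exact hβ j hj
  obtain ⟨q, q', B, h, h'⟩ := hasReflectedAbelSums_of_mem hβ' hf
  have h₀ : Function.update β 0 0 0 = 0 := Function.update_self ..
  have h₂ : Function.update β 0 0 2 = 4 * catalanG :=
    (hβ' 2 one_le_two).unique hasAbelSum_inv_add_half_sq
  generalize Function.update β 0 0 = γ at h h' h₀ h₂
  have hN : (-1 : ℝ) ^ N * (-1) ^ N = 1 := by
    rw [← pow_add, ← two_mul]; exact Even.neg_one_pow (even_two_mul N)
  -- By the symmetry of `f` the reflected series is the negative of the original one. Equating the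
  -- two values eliminates `j = 1` and `j = 3`, whatever the real numbers `γ 1` and `γ 3` are.
  have e := (h.const_mul (-1)).unique (t := q' - ∑ j ∈ Finset.range 4, (-1) ^ j * B j * γ j) (by
    convert! h' using 2 with n
    rw [hsymm]
    linear_combination ((-1) ^ n * f n) * hN)
  refine ⟨4 * B 2, (q - q') / 2, ?_⟩
  convert! h using 1
  simp only [Finset.sum_range_succ, Finset.sum_range_zero, h₀, h₂] at e ⊢
  push_cast
  linear_combination (1 / 2) * e

lemma rising_reflect (x : ℝ) (k : ℕ) : rising (1 - k - x) k = (-1) ^ k * rising x k := by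
  induction k with
  | zero => simp
  | succ k ih =>
    rw [rising_succ', rising_succ, pow_succ, show 1 - ((k + 1 : ℕ) : ℝ) - x + 1 = 1 - k - x by
      push_cast; ring, ih]
    push_cast; ring

/-- Both sides are `(x)ₙ₊ₖ / ((x)ₙ (x)ₖ)`. The index `n` on the left becomes the argument of a
polynomial on the right. -/
lemma rising_add_natCast_div {x : ℝ} (hx : 0 < x) (k n : ℕ) :
    rising (x + k) n / rising x n = rising (n + x) k / rising x k := by
  rw [div_eq_div_iff (rising_pos hx n).ne' (rising_pos hx k).ne', add_comm (n : ℝ) x, mul_comm,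
    ← rising_add, mul_comm, ← rising_add, add_comm]

lemma exists_ratCast_eq_rising (c : ℚ) (k : ℕ) : ∃ q : ℚ, rising c k = q := by
  induction k with
  | zero => exact ⟨1, by simp⟩
  | succ k ih =>
    obtain ⟨q, hq⟩ := ih
    exact ⟨q * (c + k), by rw [rising_succ, hq]; push_cast; ring⟩

lemma neg_one_pow_two_mul_add (l k : ℕ) : (-1 : ℝ) ^ (2 * l + k) = (-1) ^ k := by
  rw [pow_add, Even.neg_one_pow (even_two_mul l), one_mul]

/-- A quotient of rising factorials with half-integral arguments as a rational function. -/
lemma exists_rational_rising_div_half {N l l' : ℕ} (h : l + l' = N) :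
    ∃ g : ℤ → ℝ, (∀ n : ℕ, rising (l + 1 / 2) n / rising (l' + 1 / 2) n = g n) ∧
      (∀ z, g (-N - z) = (-1) ^ N * g z) ∧
      ∀ ord f, f ∈ partialFractions ord → (fun z => g z * f z) ∈
        partialFractions fun i => ord i + if i ∈ Finset.range N then 1 else 0 := by
  -- For `l ≤ l'` the function is a constant over a product of linear factors, with simple poles at
  -- the indices from `l` to `l' - 1`, all below `N`; otherwise it is a polynomial.
  rcases le_total l l' with hl | hl
  · obtain ⟨k, rfl⟩ := Nat.exists_eq_add_of_le hl
    obtain rfl : N = 2 * l + k := by omega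
    obtain ⟨q, hq⟩ := exists_ratCast_eq_rising (l + 1 / 2) k
    push_cast at hq
    refine ⟨fun z => rising (l + 1 / 2) k * (rising ((z : ℝ) + l + 1 / 2) k)⁻¹, fun n => ?_,
      fun z => ?_, fun ord f hf => ?_⟩
    · have := rising_add_natCast_div (show (0 : ℝ) < l + 1 / 2 by positivity) k n
      rw [← inv_inj, inv_div, inv_div, ← add_assoc] at this
      push_cast
      rw [add_right_comm, this, div_eq_mul_inv]
    · push_cast
      rw [neg_one_pow_two_mul_add, show -(2 * (l : ℝ) + k) - z + l + 1 / 2 =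
        1 - k - (z + l + 1 / 2) by ring, rising_reflect, mul_inv, ← inv_pow, inv_neg_one]
      ring
    · refine partialFractions_mono (fun i => ?_) (ratCast_mul_mem_partialFractions
        (inv_rising_mul_mem_partialFractions hf l k) q |> fun h => by
          convert! h using 1; funext z; rw [hq]; ring)
      simp only [Finset.mem_Ico, Finset.mem_range]
      split_ifs <;> omega
  · obtain ⟨k, rfl⟩ := Nat.exists_eq_add_of_le hl
    obtain rfl : N = 2 * l' + k := by omega
    obtain ⟨q, hq⟩ := exists_ratCast_eq_rising (l' + 1 / 2) k
    push_cast at hq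
    refine ⟨fun z => rising ((z : ℝ) + (l' + 1 / 2)) k / rising (l' + 1 / 2) k, fun n => ?_,
      fun z => ?_, fun ord f hf => ?_⟩
    · have := rising_add_natCast_div (show (0 : ℝ) < l' + 1 / 2 by positivity) k n
      push_cast
      rw [← this, add_right_comm]
    · push_cast
      rw [neg_one_pow_two_mul_add, show -(2 * (l' : ℝ) + k) - z + (l' + 1 / 2) =
        1 - k - (z + (l' + 1 / 2)) by ring, rising_reflect]
      ring
    · refine partialFractions_mono (ord := ord) (fun i => by simp) ?_
      have h := ratCast_mul_mem_partialFractions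
        (rising_mul_mem_partialFractions hf (l' + 1 / 2) k) q⁻¹
      convert! h using 1
      funext z
      rw [hq]; push_cast; ring

/-- A product of quotients of rising factorials with integral arguments as a polynomial. -/
lemma exists_polynomial_rising_div {N v k : ℕ} (hv : 0 < v) (h : N = v + k) :
    ∃ g : ℤ → ℝ, (∀ n : ℕ, rising (k + 1) n / n.factorial * (rising N n / rising v n) = g n) ∧
      (∀ z, g (-N - z) = g z) ∧
      ∀ ord f, f ∈ partialFractions ord → (fun z => g z * f z) ∈ partialFractions ord := by
  subst h
  have hv' : (0 : ℝ) < v := by exact_mod_cast hv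
  obtain ⟨q, hq⟩ := exists_ratCast_eq_rising v k
  push_cast at hq
  refine ⟨fun z => rising ((z : ℝ) + 1) k / rising 1 k * (rising ((z : ℝ) + v) k / rising v k),
    fun n => ?_, fun z => ?_, fun ord f hf => ?_⟩
  · have h1 := rising_add_natCast_div one_pos k n
    have h2 := rising_add_natCast_div hv' k n
    push_cast
    rw [← h1, ← h2, rising_one, add_comm (1 : ℝ) k]
  · push_cast
    have hk : (-1 : ℝ) ^ k * (-1) ^ k = 1 := by
      rw [← pow_add, ← two_mul]; exact Even.neg_one_pow (even_two_mul k)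
    rw [show -((v : ℝ) + k) - z + 1 = 1 - k - (z + v) by ring,
      show -((v : ℝ) + k) - z + v = 1 - k - (z + 1) by ring, rising_reflect, rising_reflect]
    linear_combination rising ((z : ℝ) + 1) k / rising 1 k *
      (rising ((z : ℝ) + v) k / rising v k) * hk
  · have h := ratCast_mul_mem_partialFractions (rising_mul_mem_partialFractions
      (rising_mul_mem_partialFractions hf v k) 1 k) ((k.factorial : ℚ)⁻¹ * q⁻¹)
    convert! h using 1
    funext z
    rw [hq, rising_one]; push_cast; ring

/-! ### Arithmetic of the values -/

/-- Each of the three half-integral quotients has at most simple poles and contributes `(-1)ᴺ` under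
`z ↦ -N - z`. The integral quotients form an invariant polynomial, and the very-well-poised factor
`z + N/2` is odd. Hence the poles are at most triple and the total sign is `-(-1)ᴺ`. -/
lemma exists_hasAbelSum_hgCoeff {N l₁ l₁' l₂ l₂' l₃ l₃' v k : ℕ} (hv : 0 < v) (h₁ : l₁ + l₁' = N)
    (h₂ : l₂ + l₂' = N) (h₃ : l₃ + l₃' = N) (h₄ : N = v + k) :
    ∃ p q : ℚ, HasAbelSum (fun n => hgCoeff
      [(N : ℝ), 1 + N / 2, l₁ + 1 / 2, l₂ + 1 / 2, l₃ + 1 / 2, k + 1]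
      [(N : ℝ) / 2, l₁' + 1 / 2, l₂' + 1 / 2, l₃' + 1 / 2, v] n * (-1) ^ n) (p * catalanG + q) := by
  have hN : (0 : ℝ) < N := by
    have : 0 < N := by omega
    exact_mod_cast this
  obtain ⟨g₁, e₁, s₁, m₁⟩ := exists_rational_rising_div_half h₁
  obtain ⟨g₂, e₂, s₂, m₂⟩ := exists_rational_rising_div_half h₂
  obtain ⟨g₃, e₃, s₃, m₃⟩ := exists_rational_rising_div_half h₃
  obtain ⟨g₄, e₄, s₄, m₄⟩ := exists_polynomial_rising_div hv h₄
  have hone : (fun _ : ℤ => (1 : ℝ)) ∈ partialFractions fun _ => 0 := by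
    simpa using pow_mem_partialFractions (fun _ => 0) 0
  have hmem := ratCast_mul_mem_partialFractions (add_mul_mem_partialFractions
    (m₄ _ _ (m₃ _ _ (m₂ _ _ (m₁ _ _ hone)))) (N / 2)) (2 / N)
  have hpow : (-1 : ℝ) ^ N * (-1) ^ N = 1 := by
    rw [← pow_add, ← two_mul]; exact Even.neg_one_pow (even_two_mul N)
  obtain ⟨p, q, h⟩ := exists_hasAbelSum_catalanG (N := N) (partialFractions_mono (fun i => by
    simp only; split_ifs <;> simp) hmem) (fun z => by
      rw [s₁, s₂, s₃, s₄]
      push_cast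
      linear_combination (-(2 / N * (z + N / 2) * (g₄ z * g₃ z * g₂ z * g₁ z)) * (-1) ^ N) * hpow)
  refine ⟨p, q, ?_⟩
  convert! h using 2 with n
  have e₅ := rising_add_natCast_div (half_pos hN) 1 n
  have e₀ : ∀ x, rising x 1 = x := fun x => by simp [rising_succ']
  rw [e₀, e₀, Nat.cast_one] at e₅
  rw [← e₁, ← e₂, ← e₃, ← e₄]
  change rising _ n * (rising _ n * (rising _ n * (rising _ n * (rising _ n * (rising _ n * 1))))) /
    (n.factorial * (rising _ n * (rising _ n * (rising _ n * (rising _ n * (rising _ n * 1)))))) *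
    (-1) ^ n = _
  rw [add_comm (1 : ℝ) (N / 2)]
  push_cast
  have e₆ : 2 / (N : ℝ) * (n + N / 2) = rising (N / 2 + 1) n / rising (N / 2) n := by
    rw [e₅]; field_simp
  rw [← mul_assoc (2 / (N : ℝ)), e₆]
  simp only [div_eq_mul_inv, mul_inv]
  ring

lemma exists_gamma_natCast_add_half (n : ℕ) :
    ∃ q : ℚ, q ≠ 0 ∧ Real.Gamma (n + 1 / 2) = q * √Real.pi := by
  refine ⟨(2 * n - 1 : ℕ).doubleFactorial / 2 ^ n, ?_, ?_⟩
  · have := Nat.doubleFactorial_pos (2 * n - 1)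
    positivity
  · rw [Real.Gamma_nat_add_half]; push_cast; ring

lemma IsInt.exists_natCast {x : ℝ} (h : IsInt x) (hx : -1 < x) : ∃ n : ℕ, x = n := by
  obtain ⟨m, rfl⟩ := h
  have : -1 < m := by exact_mod_cast hx
  lift m to ℕ using by omega
  exact ⟨m, by simp⟩

lemma IsHalfInt.exists_natCast {x : ℝ} (h : IsHalfInt x) (hx : -1 < x) :
    ∃ n : ℕ, x + 1 = n + 1 / 2 := by
  obtain ⟨m, rfl⟩ := h
  have h1 : (-2 : ℝ) < m := by linarith
  have : -2 < m := by exact_mod_cast h1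
  obtain ⟨n, hn⟩ : ∃ n : ℕ, m + 1 = n := ⟨(m + 1).toNat, by omega⟩
  have hn' : (m : ℝ) + 1 = n := by exact_mod_cast hn
  exact ⟨n, by linarith⟩

lemma IsInt.exists_gamma {x : ℝ} (h : IsInt x) (hx : -1 < x) :
    ∃ q : ℚ, q ≠ 0 ∧ Real.Gamma (x + 1) = q := by
  obtain ⟨n, rfl⟩ := h.exists_natCast hx
  exact ⟨n.factorial, by positivity, by rw [Real.Gamma_nat_eq_factorial]; simp⟩

lemma IsHalfInt.exists_gamma {x : ℝ} (h : IsHalfInt x) (hx : -1 < x) :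
    ∃ q : ℚ, q ≠ 0 ∧ Real.Gamma (x + 1) = q * √Real.pi := by
  obtain ⟨n, hn⟩ := h.exists_natCast hx
  rw [hn]
  exact exists_gamma_natCast_add_half n

lemma exists_H_eq_of_halfIntegrality {a₁ a₂ a₃ b₂ b₃ : ℝ}
    (hc : ∀ i, -1 < paramSet a₁ a₂ a₃ b₂ b₃ i)
    (h : HalfIntegrality (paramSet a₁ a₂ a₃ b₂ b₃)) :
    ∃ p q : ℚ, H (paramSet a₁ a₂ a₃ b₂ b₃) = p * catalanG + q := by
  obtain ⟨r, hr⟩ := h.1.exists_natCast (hc c00)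
  obtain ⟨l, hl⟩ := h.2.1.exists_natCast (hc c21)
  obtain ⟨j, hj⟩ := h.2.2.1.exists_natCast (hc c33)
  obtain ⟨i, hi⟩ := h.2.2.2.1.exists_natCast (hc c22)
  obtain ⟨k, hk⟩ := h.2.2.2.2.exists_natCast (hc c31)
  have h12 := hc c12
  have h13 := hc c13
  simp only [paramSet] at hr hl hj hi hk h12 h13
  obtain rfl : a₂ = l + 1 / 2 := by linarith
  obtain rfl : a₃ = k + 1 := by linarith
  obtain rfl : b₂ = l + i + 3 / 2 := by linarith
  obtain rfl : b₃ = k + j + 3 / 2 := by linarith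
  obtain rfl : a₁ = i + j + 1 - r := by linarith
  -- The conditions `c₁₃ > -1` and `c₁₂ > -1` say `h₁ > 0` and `h₂ > 0`, that is, `l₁` and `l₂` are
  -- natural numbers.
  obtain ⟨l₁, hl₁⟩ : ∃ l₁, k + r = l₁ + i := by
    have : (i : ℝ) < ((k + r + 1 : ℕ) : ℝ) := by push_cast; linarith
    have : i < k + r + 1 := by exact_mod_cast this
    exact ⟨k + r - i, by omega⟩
  obtain ⟨l₂, hl₂⟩ : ∃ l₂, l + r = l₂ + j := by
    have : (j : ℝ) < ((l + r + 1 : ℕ) : ℝ) := by push_cast; linarith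
    have : j < l + r + 1 := by exact_mod_cast this
    exact ⟨l + r - j, by omega⟩
  have hl₁' : (k : ℝ) + r = l₁ + i := by exact_mod_cast hl₁
  have hl₂' : (l : ℝ) + r = l₂ + j := by exact_mod_cast hl₂
  obtain ⟨p, q, hpq⟩ := exists_hasAbelSum_hgCoeff (N := l + k + r + 1) (l₁ := l₁)
    (l₁' := l + i + 1) (l₂ := l₂) (l₂' := k + j + 1) (l₃ := l) (l₃' := k + r + 1) (v := l + r + 1)
    (k := k) (by omega) (by omega) (by omega) (by omega) (by omega)
  have hH := hasAbelSum_term₆F₅ (h₀ := (l + k + r + 1 : ℕ)) (h₁ := l₁ + 1 / 2) (h₂ := l₂ + 1 / 2)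
    (by push_cast; linarith) (by push_cast; linarith) (by push_cast; linarith) hc
    (by positivity)
  obtain ⟨q₁, -, hq₁⟩ := exists_gamma_natCast_add_half l
  obtain ⟨q₂, -, hq₂⟩ := exists_gamma_natCast_add_half j
  obtain ⟨q₃, -, hq₃⟩ := exists_gamma_natCast_add_half r
  obtain ⟨q₄, hq₄', hq₄⟩ := exists_gamma_natCast_add_half (l + i + 1)
  obtain ⟨q₅, hq₅', hq₅⟩ := exists_gamma_natCast_add_half (k + j + 1)
  obtain ⟨q₆, hq₆', hq₆⟩ := exists_gamma_natCast_add_half (k + r + 1)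
  -- The prefactor has three Gamma values at half-integers above and three below, so the powers of
  -- `√π` cancel and a rational constant remains.
  obtain ⟨C, hC⟩ : ∃ C : ℚ, C = (l + k + r + 1).factorial * q₁ * k.factorial * i.factorial * q₂ *
    q₃ / (q₄ * q₅ * q₆ * (l + r).factorial) := ⟨_, rfl⟩
  have hval := hH.unique (t := C * (p * catalanG + q)) (by
    convert! hpq.const_mul C using 2 with n
    simp only [term₆F₅]
    have d₁ : 1 + ((l + k + r + 1 : ℕ) : ℝ) - (l₁ + 1 / 2) = (l + i + 1 : ℕ) + 1 / 2 := by
      push_cast; linarith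
    have d₂ : 1 + ((l + k + r + 1 : ℕ) : ℝ) - (l₂ + 1 / 2) = (k + j + 1 : ℕ) + 1 / 2 := by
      push_cast; linarith
    have d₃ : 1 + ((l + k + r + 1 : ℕ) : ℝ) - (l + 1 / 2) = (k + r + 1 : ℕ) + 1 / 2 := by
      push_cast; ring
    have d₄ : 1 + ((l + k + r + 1 : ℕ) : ℝ) - (k + 1) = (l + r + 1 : ℕ) := by
      push_cast; ring
    rw [d₁, d₂, d₃, d₄]
    congr 1
    have d₅ : ((l + i + 1 : ℕ) : ℝ) + 1 / 2 - (l + 1 / 2) = i + 1 := by push_cast; ring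
    have d₆ : ((k + j + 1 : ℕ) : ℝ) + 1 / 2 - (k + 1) = j + 1 / 2 := by push_cast; ring
    have d₇ : ((k + r + 1 : ℕ) : ℝ) + 1 / 2 - (k + 1) = r + 1 / 2 := by push_cast; ring
    rw [d₅, d₆, d₇, hq₁, hq₂, hq₃, hq₄, hq₅, hq₆, add_comm 1 ((l + k + r + 1 : ℕ) : ℝ),
      Real.Gamma_nat_eq_factorial, Real.Gamma_nat_eq_factorial, Real.Gamma_nat_eq_factorial,
      Nat.cast_add_one (l + r), Real.Gamma_nat_eq_factorial, hC]
    have hpi : √Real.pi ≠ 0 := (Real.sqrt_pos.2 Real.pi_pos).ne'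
    have c₄ : (q₄ : ℝ) ≠ 0 := by exact_mod_cast hq₄'
    have c₅ : (q₅ : ℝ) ≠ 0 := by exact_mod_cast hq₅'
    have c₆ : (q₆ : ℝ) ≠ 0 := by exact_mod_cast hq₆'
    push_cast
    field_simp)
  exact ⟨C * p, C * q, by rw [hval]; push_cast; ring⟩

/-! ### Transport of the half-integrality condition along the group. -/

/-- Four labels sharing an index carry integers, the other six carry half-integers. -/
def IsStar (c : Idx → ℝ) (x : Fin 5) : Prop :=
  ∀ i, (x ∈ pair i → IsInt (c i)) ∧ (x ∉ pair i → IsHalfInt (c i))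

/-- Each of the other five elements has the form `x + y - z` with `x, y, z` among the five in the
condition. -/
lemma HalfIntegrality.isStar {c : Idx → ℝ} (h : HalfIntegrality c) (hc : IsParamSet c) :
    IsStar c 3 := by
  obtain ⟨a₁, a₂, a₃, b₂, b₃, rfl⟩ := hc
  obtain ⟨⟨m₀, h₀⟩, ⟨m₁, h₁⟩, ⟨m₂, h₂⟩, ⟨m₃, h₃⟩, ⟨m₄, h₄⟩⟩ := h
  simp only [paramSet] at h₀ h₁ h₂ h₃ h₄
  intro i
  cases i
  · exact ⟨fun h => absurd h (by decide), fun _ => ⟨m₀, h₀⟩⟩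
  · exact ⟨fun _ => ⟨m₃ + m₂ - m₀, by simp only [paramSet]; push_cast; linarith⟩,
      fun h => absurd (by decide) h⟩
  · exact ⟨fun h => absurd h (by decide),
      fun _ => ⟨m₁ + m₀ - m₂, by simp only [paramSet]; push_cast; linarith⟩⟩
  · exact ⟨fun h => absurd h (by decide),
      fun _ => ⟨m₄ + m₀ - m₃, by simp only [paramSet]; push_cast; linarith⟩⟩
  · exact ⟨fun h => absurd h (by decide), fun _ => ⟨m₁, h₁⟩⟩
  · exact ⟨fun _ => ⟨m₃, h₃⟩, fun h => absurd (by decide) h⟩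
  · exact ⟨fun _ => ⟨m₂ + m₄ - m₁, by simp only [paramSet]; push_cast; linarith⟩,
      fun h => absurd (by decide) h⟩
  · exact ⟨fun _ => ⟨m₄, h₄⟩, fun h => absurd (by decide) h⟩
  · exact ⟨fun h => absurd h (by decide),
      fun _ => ⟨m₃ + m₁ - m₄, by simp only [paramSet]; push_cast; linarith⟩⟩
  · exact ⟨fun h => absurd h (by decide), fun _ => ⟨m₂, h₂⟩⟩

lemma IsStar.of_act {c : Idx → ℝ} {ρ : Equiv.Perm (Fin 5)} {x : Fin 5}
    (h : IsStar (act (symmHom ρ) c) (ρ x)) : IsStar c x := by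
  intro i
  have := h (symmHom ρ i)
  rw [pair_symmHom, act, ← Equiv.Perm.mul_apply, inv_mul_cancel] at this
  simpa using this

/-- The five labels in `gammaProd` are the edges of a pentagon on the five points. Every point lies
on exactly two of them, so three Gamma values are at half-integers wherever the star is centred. -/
lemma IsStar.exists_gammaProd {c : Idx → ℝ} {x : Fin 5} (h : IsStar c x) (hc : ∀ i, -1 < c i) :
    ∃ q : ℚ, q ≠ 0 ∧ gammaProd c = q * √Real.pi ^ 3 := by
  have hI : ∀ i, ∃ q : ℚ, q ≠ 0 ∧
      Real.Gamma (c i + 1) = q * √Real.pi ^ (if x ∈ pair i then 0 else 1) := fun i => by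
    split_ifs with hx
    · simpa using ((h i).1 hx).exists_gamma (hc i)
    · simpa using ((h i).2 hx).exists_gamma (hc i)
  choose q hq hΓ using hI
  refine ⟨q c00 * q c21 * q c22 * q c33 * q c31, by simp [hq], ?_⟩
  have hcard : ∀ x, (if x ∈ pair c00 then 0 else 1) + (if x ∈ pair c21 then 0 else 1) +
      (if x ∈ pair c22 then 0 else 1) + (if x ∈ pair c33 then 0 else 1) +
      (if x ∈ pair c31 then 0 else 1) = 3 := by decide
  rw [gammaProd, hΓ, hΓ, hΓ, hΓ, hΓ, ← hcard x]
  push_cast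
  simp only [pow_add]
  ring

/-- By invariance `H c` is `H (act σ c)` times a quotient of two Gamma products, and the factors `√π
^ 3` cancel in that quotient. -/
lemma exists_H_eq_of_halfIntegrality_act {c : Idx → ℝ} (hc : IsParamSet c) (hpos : ∀ i, -1 < c i)
    {σ : Equiv.Perm Idx} (hσ : σ ∈ permGroup) (h : HalfIntegrality (act σ c)) :
    ∃ p q : ℚ, H c = p * catalanG + q := by
  have hσc := isParamSet_act hσ hc
  have hstar := h.isStar hσc
  obtain ⟨r, hr, hr'⟩ := hstar.exists_gammaProd (lt_act hpos σ)
  have hinv := H_div_gammaProd_act hσ hc hpos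
  rw [← range_symmHom] at hσ
  obtain ⟨ρ, rfl⟩ := hσ
  obtain ⟨s, hs, hs'⟩ := (IsStar.of_act (ρ := ρ) (x := ρ⁻¹ 3) (by
    rwa [← Equiv.Perm.mul_apply, mul_inv_cancel, Equiv.Perm.one_apply])).exists_gammaProd hpos
  obtain ⟨p, q, hpq⟩ : ∃ p q : ℚ, H (act (symmHom ρ) c) = p * catalanG + q := by
    have hpos' := lt_act hpos (symmHom ρ)
    generalize act (symmHom ρ) c = d at hσc h hpos'
    obtain ⟨a₁, a₂, a₃, b₂, b₃, rfl⟩ := hσc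
    exact exists_H_eq_of_halfIntegrality hpos' h
  refine ⟨s / r * p, s / r * q, ?_⟩
  have hpi : √Real.pi ≠ 0 := (Real.sqrt_pos.2 Real.pi_pos).ne'
  have hr0 : (r : ℝ) ≠ 0 := by exact_mod_cast hr
  have hs0 : (s : ℝ) ≠ 0 := by exact_mod_cast hs
  rw [hpq, hr', hs', div_eq_div_iff (by positivity) (by positivity)] at hinv
  push_cast
  field_simp
  refine mul_right_cancel₀ (pow_ne_zero 3 hpi) ?_
  linear_combination -hinv

end CatalanForms

theorem theorem3 :
    Nat.card permGroup = 120 ∧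
    ∀ (h₀ h₁ h₂ h₃ h₄ a₁ a₂ a₃ b₂ b₃ : ℝ) (c : Idx → ℝ),
      a₁ = 1 + h₀ - h₁ - h₂ → a₂ = h₃ → a₃ = h₄ → b₂ = 1 + h₀ - h₁ → b₃ = 1 + h₀ - h₂ →
      c = paramSet a₁ a₂ a₃ b₂ b₃ →
      (∀ i, -1 < c i) →
      -- the double integral converges and equals the two hypergeometric expressions
      IntegrableOn (integrand c) unitSquare ∧
      HasSum (term₃F₂ a₁ a₂ a₃ b₂ b₃) (H c) ∧
      (h₀ ≠ 0 → HasAbelSum (term₆F₅ h₀ h₁ h₂ h₃ h₄) (H c)) ∧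
      -- the group acts on the sets `c`, and the normalized quantity is invariant
      (∀ σ ∈ permGroup, IsParamSet (act σ c) ∧
        H (act σ c) / gammaProd (act σ c) = H c / gammaProd c) ∧
      -- the arithmetic claim
      ((∃ σ ∈ permGroup, HalfIntegrality (act σ c)) →
        ∃ p q : ℚ, H c = (p : ℝ) * catalanG + (q : ℝ)) := by
  refine ⟨card_permGroup, fun h₀ h₁ h₂ h₃ h₄ a₁ a₂ a₃ b₂ b₃ c ha₁ ha₂ ha₃ hb₂ hb₃ hc hpos => ?_⟩
  subst ha₂ ha₃ hc
  have hset : IsParamSet (paramSet a₁ a₂ a₃ b₂ b₃) := ⟨_, _, _, _, _, rfl⟩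
  exact ⟨integrableOn_integrand hpos, hasSum_term₃F₂ hpos, hasAbelSum_term₆F₅ ha₁ hb₂ hb₃ hpos,
    fun σ hσ => ⟨isParamSet_act hσ hset, H_div_gammaProd_act hσ hset hpos⟩,
    fun ⟨σ, hσ, h⟩ => exists_H_eq_of_halfIntegrality_act hset hpos hσ h⟩
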